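/- Let $h\le N$, let $\sigma_{i,j}\in C^1(\mathbb R^N\setminus\{0\})$ be real-valued for $1\le i\le h$, $1\le j\le N$, and let $X_i=\sum_{j=1}^N\sigma_{i,j}\,\partial/\partial x_j$, $\nabla_{\mathcal L}=(X_1,\dots,X_h)$, $X_i^*g=-\sum_{j}\partial_{x_j}(\sigma_{i,j}g)$ and $\mathcal L=-\sum_{i=1}^hX_i^*X_i=\operatorname{div}(\sigma^T\sigma\nabla\,\cdot\,)$. Let $d:\mathbb R^N\setminus\{0\}\to(0,\infty)$ be $C^\infty$, with $|\nabla_{\mathcal L}d|\ne0$ almost everywhere and, for a.e. $r>0$, $\nabla d\neq0$ on $\{d=r\}$. Let $p\ge2$ and $\beta,\theta\in\mathbb R$ be such that $$\mathcal Ld=\frac{(1-\beta)|\nabla_{\mathcal L}d|^2}{d}\ \text{ in }\mathbb R^N\setminus\{0\},\qquad d^{-p\theta}|\nabla_{\mathcal L}d|^{-2(p-1)}\in L^1_{\rm loc}(\mathbb R^N\setminus\{0\}),$$ $$(2-\beta-p\theta-2p)(p\theta+2p-2-\beta(p-1))\ge0,$$ and put $$C=\frac{(2-\beta-p\theta-2p)(p\theta+2p-2-\beta(p-1))}{p^2},\qquad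 \gamma=\frac{\beta+p\theta+2p-2}{p}.$$ **(1) Inequality.** For every real-valued $u\in C_c^\infty(\mathbb R^N\setminus\{0\})$ both integrals below are finite and $$C^p\int_{\mathbb R^N}\frac{|u|^p}{d^{p(\theta+2)}}|\nabla_{\mathcal L}d|^2\,dx\ \le\ \int_{\mathbb R^N}\frac{|\mathcal Lu|^p}{d^{p\theta}|\nabla_{\mathcal L}d|^{2(p-1)}}\,dx .\tag{R}$$ **(2) Sharpness and maximizing functions.** Suppose in addition that there is $\lambda>0$ with $$\int_{\{d=r\}}\frac{|\nabla_{\mathcal L}d|^2}{|\nabla d|}\,d\mathcal H_{N-1}=\lambda\,r^{1-\beta}\qquad\text{for a.e. }r>0 .$$ Call $v\in C^2(\mathbb R^N\setminus\{0\})$ *maximizing* if there are $u_n\in C_c^\infty(\mathbb R^N\setminus\{0\})$ such that $u_n\to v$ together with all derivatives of order at most two, uniformly on compact subsets of $\mathbb R^N\setminus\{0\}$, and such that the difference of the right-hand and left-hand sides of (R) for $u=u_n$ tends to $0$ (equality in (R) in the generalized sense appropriate for functions for which both integrals may diverge). Then: (a) If the sets $\{x\ne0: a\le d(x)\le b\}$,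 $0<a\le b$, are compact, then the constant $C^p$ is sharp, that is, it equals the infimum over $0\ne u\in C_c^\infty(\mathbb R^N\setminus\{0\})$ of the quotient of the right-hand integral of (R) by the left-hand integral, and $d^{\gamma}$ is maximizing. (b) No nonzero $u\in C_c^\infty(\mathbb R^N\setminus\{0\})$ achieves equality in (R). (c) If $C>0$, every maximizing $v$ satisfies $\nabla_{\mathcal L}(d^{-\gamma}v)=0$ in $\mathbb R^N\setminus\{0\}$. If, moreover, every $w\in C^1(\mathbb R^N\setminus\{0\})$ with $\nabla_{\mathcal L}w=0$ is constant, then $v=c\,d^\gamma$ for some $c\in\mathbb R$; so $d^\gamma$ is then the only possible maximizing function up to multiplicative constants. -/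

import Mathlib

open MeasureTheory Filter Topology
open scoped ContDiff Gradient

noncomputable section

namespace Rellich

/-- The Euclidean space `ℝ^N`. -/
abbrev E (N : ℕ) := EuclideanSpace ℝ (Fin N)

/-- The partial derivative `∂f/∂x_j` at `x`. -/
def pderiv {N : ℕ} (j : Fin N) (f : E N → ℝ) (x : E N) : ℝ :=
  fderiv ℝ f x (EuclideanSpace.single j 1)

/-- The gradient `∇_L f = (X_1 f, …, X_h f)` of the vector fields
`X_i = ∑_j σ_{i,j} ∂/∂x_j`, as a vector of the Euclidean space `ℝ^h`. -/
def gradL {N h : ℕ} (σ : Fin h → Fin N → E N → ℝ) (f : E N → ℝ) (x : E N) :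
    EuclideanSpace ℝ (Fin h) :=
  WithLp.toLp 2 fun i => ∑ j, σ i j x * pderiv j f x

/-- The formal adjoint `X_i^* g = - ∑_j ∂(σ_{i,j} g)/∂x_j`; here `s` is the row `σ_i`. -/
def adjointField {N : ℕ} (s : Fin N → E N → ℝ) (g : E N → ℝ) (x : E N) : ℝ :=
  -∑ j, pderiv j (fun y => s j y * g y) x

/-- The operator `L f = - ∑_i X_i^* X_i f = div (σᵀ σ ∇ f)`. -/
def opL {N h : ℕ} (σ : Fin h → Fin N → E N → ℝ) (f : E N → ℝ) (x : E N) : ℝ :=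
  -∑ i, adjointField (σ i) (fun y => gradL σ f y i) x

/-- `u ∈ C_c^∞(ℝ^N ∖ {0})`, extended by zero to `ℝ^N`. -/
structure IsTest {N : ℕ} (u : E N → ℝ) : Prop where
  smooth : ContDiff ℝ ∞ u
  compact : HasCompactSupport u
  support : tsupport u ⊆ {0}ᶜ

/-- The integrand `|u|^p / d^{p(θ+2)} |∇_L d|^2`. -/
def lowDensity {N h : ℕ} (σ : Fin h → Fin N → E N → ℝ) (d : E N → ℝ) (p θ : ℝ)
    (u : E N → ℝ) (x : E N) : ℝ :=
  |u x| ^ p / d x ^ (p * (θ + 2)) * ‖gradL σ d x‖ ^ 2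

/-- The integrand `|L u|^p / (d^{pθ} |∇_L d|^{2(p-1)})`. -/
def highDensity {N h : ℕ} (σ : Fin h → Fin N → E N → ℝ) (d : E N → ℝ) (p θ : ℝ)
    (u : E N → ℝ) (x : E N) : ℝ :=
  |opL σ u x| ^ p / (d x ^ (p * θ) * ‖gradL σ d x‖ ^ (2 * (p - 1)))

/-- The constant `C = (2-β-pθ-2p)(pθ+2p-2-β(p-1)) / p^2`; the inequality holds with `C^p`. -/
def const (β p θ : ℝ) : ℝ :=
  (2 - β - p * θ - 2 * p) * (p * θ + 2 * p - 2 - β * (p - 1)) / p ^ 2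

/-- Convergence `u_n → v` in `C^2_loc(ℝ^N ∖ {0})`: all derivatives of order at most two converge
uniformly on every compact subset of `ℝ^N ∖ {0}`. -/
def TendstoC2Loc {N : ℕ} (u : ℕ → E N → ℝ) (v : E N → ℝ) : Prop :=
  ∀ K : Set (E N), IsCompact K → K ⊆ {0}ᶜ → ∀ k ≤ 2,
    TendstoUniformlyOn (fun n => iteratedFDeriv ℝ k (u n)) (iteratedFDeriv ℝ k v) atTop K

/-- `v ∈ C^2(ℝ^N ∖ {0})` achieves the equality in the Rellich inequality with constant `C^p`,
in the generalized sense needed for functions that are not admissible (for which both integrals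
may be infinite): `v` is the limit of admissible functions along which the difference of the two
sides of the inequality tends to zero. For an admissible `v` that achieves the equality a constant
sequence will do. -/
def IsMaximizing {N h : ℕ} (σ : Fin h → Fin N → E N → ℝ) (d : E N → ℝ) (β p θ : ℝ)
    (v : E N → ℝ) : Prop :=
  ContDiffOn ℝ 2 v {0}ᶜ ∧
  ∃ u : ℕ → E N → ℝ, (∀ n, IsTest (u n)) ∧ TendstoC2Loc u v ∧
    Tendsto (fun n => (∫ x, highDensity σ d p θ (u n) x)
      - const β p θ ^ p * ∫ x, lowDensity σ d p θ (u n) x) atTop (𝓝 0)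

end Rellich

end

namespace Rellich

/-! ### Product and chain rules for the vector fields and the operator -/

section Calculus

variable {N h : ℕ} {σ : Fin h → Fin N → E N → ℝ}

/-! Put `s = pθ + 2p - 2`, so that `pγ = β + s` and `C = γ(β - γ)`. Two applications of Green's
formula, one with `L u` and one with the equation for `d`, give for test functions the identity
`(p-1) ∫ R + C ∫ |u|^p d^{-s-2} |∇_L d|² + ∫ |u|^{p-2} u d^{-s} L u = 0`, where `R = |u|^{p-2}
d^{-s} |∇_L u - γ (u/d) ∇_L d|²` (`integral_remDensity`). The tangent inequality for `|·|^p`, used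
at the point `C u` and evaluated at `-d² |∇_L d|^{-2} L u`, turns this into a bound on the deficit
of (R): it is at least `p(p-1) C^{p-1} ∫ R ≥ 0` (`deficit_ge`).

The vector in `R` is `d^γ ∇_L(d^{-γ} u)`, so for `C > 0` a vanishing deficit forces `∇_L(d^{-γ} u) =
0`. With compact support this gives `u = 0` (`eq_zero_of_gradL_eq_zero`), hence strict inequality;
if `C = 0`, equality makes `L u = 0` almost everywhere and the identity again gives `∫ R = 0`
(`strict_inequality`). Along a maximizing sequence `∫ R` tends to zero, and Fatou's lemma passes
this to the limit (`gradL_weighted_eq_zero_of_isMaximizing`).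

For sharpness, functions of `t = log d` reduce everything to the line: `L` acts as `f'' - β f'` up
to a weight, and the measure `d^{β-2} |∇_L d|² dx` is carried by `log d` to a positive multiple of
Lebesgue measure (`exists_integral_radial`). For `u = d^γ η(ε log d)` the deficit is a multiple of
`ε⁻¹ (∫ |ε² η'' + (2γ-β) ε η' - C η|^p - ∫ |C η|^p)`. Its limit is the integral of a multiple of
`(|η|^p)'`, which is zero (`exists_tendsto_deficit_bound`). These functions converge to `d^γ`. -/

lemma isOpen_punctured : IsOpen ({0}ᶜ : Set (E N)) := isOpen_compl_singleton

lemma punctured_mem_nhds {x : E N} (hx : x ≠ 0) : ({0}ᶜ : Set (E N)) ∈ 𝓝 x :=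
  isOpen_punctured.mem_nhds hx

lemma pderiv_mul {j : Fin N} {f g : E N → ℝ} {x : E N} (hf : DifferentiableAt ℝ f x)
    (hg : DifferentiableAt ℝ g x) :
    pderiv j (fun y => f y * g y) x = f x * pderiv j g x + g x * pderiv j f x := by
  simp only [pderiv]
  rw [fderiv_fun_mul hf hg]
  simp

lemma pderiv_comp {j : Fin N} {f : E N → ℝ} {x : E N} {φ : ℝ → ℝ} {φ' : ℝ}
    (hφ : HasDerivAt φ φ' (f x)) (hf : DifferentiableAt ℝ f x) :
    pderiv j (fun y => φ (f y)) x = φ' * pderiv j f x := by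
  simp only [pderiv]
  have := (hφ.comp_hasFDerivAt x hf.hasFDerivAt).fderiv
  rw [show (fun y => φ (f y)) = φ ∘ f from rfl, this]
  simp

lemma pderiv_congr {j : Fin N} {f g : E N → ℝ} {x : E N} (hfg : f =ᶠ[𝓝 x] g) :
    pderiv j f x = pderiv j g x := by
  simp only [pderiv, hfg.fderiv_eq]

lemma gradL_apply (f : E N → ℝ) (x : E N) (i : Fin h) :
    gradL σ f x i = ∑ j, σ i j x * pderiv j f x := rfl

lemma gradL_mul {f g : E N → ℝ} {x : E N} (hf : DifferentiableAt ℝ f x)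
    (hg : DifferentiableAt ℝ g x) :
    gradL σ (fun y => f y * g y) x = f x • gradL σ g x + g x • gradL σ f x := by
  ext i
  simp only [gradL_apply, PiLp.add_apply, PiLp.smul_apply, smul_eq_mul, Finset.mul_sum,
    ← Finset.sum_add_distrib, pderiv_mul hf hg]
  exact Finset.sum_congr rfl fun j _ => by ring

lemma gradL_comp {f : E N → ℝ} {x : E N} {φ : ℝ → ℝ} {φ' : ℝ}
    (hφ : HasDerivAt φ φ' (f x)) (hf : DifferentiableAt ℝ f x) :
    gradL σ (fun y => φ (f y)) x = φ' • gradL σ f x := by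
  ext i
  simp only [gradL_apply, PiLp.smul_apply, smul_eq_mul, Finset.mul_sum, pderiv_comp hφ hf]
  exact Finset.sum_congr rfl fun j _ => by ring

lemma gradL_congr {f g : E N → ℝ} {x : E N} (hfg : f =ᶠ[𝓝 x] g) :
    gradL σ f x = gradL σ g x := by
  ext i
  simp only [gradL_apply, pderiv_congr hfg]

lemma gradL_zero (x : E N) : gradL σ (fun _ => 0) x = 0 := by
  ext i
  simp [gradL_apply, pderiv]

lemma opL_eq_sum (f : E N → ℝ) (x : E N) :
    opL σ f x = ∑ i, ∑ j, pderiv j (fun y => σ i j y * gradL σ f y i) x := by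
  simp [opL, adjointField]

lemma opL_congr {f g : E N → ℝ} {x : E N} (hfg : f =ᶠ[𝓝 x] g) :
    opL σ f x = opL σ g x := by
  simp only [opL_eq_sum]
  refine Finset.sum_congr rfl fun i _ => Finset.sum_congr rfl fun j _ => pderiv_congr ?_
  filter_upwards [hfg.eventuallyEq_nhds] with y hy
  rw [gradL_congr hy]

lemma opL_zero (x : E N) : opL σ (fun _ => 0) x = 0 := by
  simp [opL_eq_sum, gradL_zero, pderiv]

lemma contDiffOn_pderiv {j : Fin N} {f : E N → ℝ} {m n : WithTop ℕ∞}
    (hf : ContDiffOn ℝ n f {0}ᶜ) (hmn : m + 1 ≤ n) : ContDiffOn ℝ m (pderiv j f) {0}ᶜ :=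
  (hf.fderiv_of_isOpen isOpen_punctured hmn).clm_apply contDiffOn_const

lemma contDiffOn_gradL_apply (hσ : ∀ i j, ContDiffOn ℝ 1 (σ i j) {0}ᶜ) {f : E N → ℝ}
    (hf : ContDiffOn ℝ 2 f {0}ᶜ) (i : Fin h) :
    ContDiffOn ℝ 1 (fun y => gradL σ f y i) {0}ᶜ := by
  simp only [gradL_apply]
  exact ContDiffOn.sum fun j _ => (hσ i j).mul (contDiffOn_pderiv hf (by norm_num))

lemma continuousOn_gradL (hσ : ∀ i j, ContDiffOn ℝ 1 (σ i j) {0}ᶜ) {f : E N → ℝ}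
    (hf : ContDiffOn ℝ 1 f {0}ᶜ) : ContinuousOn (gradL σ f) {0}ᶜ := by
  unfold gradL
  refine (PiLp.continuous_toLp 2 _).comp_continuousOn (continuousOn_pi.2 fun i => ?_)
  exact continuousOn_finsetSum _ fun j _ => (hσ i j).continuousOn.mul
    (contDiffOn_pderiv (m := 0) hf (by norm_num)).continuousOn

lemma continuousOn_opL (hσ : ∀ i j, ContDiffOn ℝ 1 (σ i j) {0}ᶜ) {f : E N → ℝ}
    (hf : ContDiffOn ℝ 2 f {0}ᶜ) : ContinuousOn (opL σ f) {0}ᶜ := by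
  have : opL σ f = fun x => ∑ i, ∑ j, pderiv j (fun y => σ i j y * gradL σ f y i) x :=
    funext fun x => opL_eq_sum f x
  rw [this]
  exact continuousOn_finsetSum _ fun i _ => continuousOn_finsetSum _ fun j _ =>
    (contDiffOn_pderiv (m := 0) ((hσ i j).mul (contDiffOn_gradL_apply hσ hf i))
      (by norm_num)).continuousOn

lemma differentiableAt_of_contDiffOn {f : E N → ℝ} {n : WithTop ℕ∞}
    (hf : ContDiffOn ℝ n f {0}ᶜ) (hn : n ≠ 0) {x : E N} (hx : x ≠ 0) : DifferentiableAt ℝ f x :=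
  (hf.contDiffAt (punctured_mem_nhds hx)).differentiableAt hn

/-- The product rule `div (F A ∇g) = F L g + ⟨∇_L F, ∇_L g⟩` with `A = σᵀ σ`. -/
lemma sum_pderiv_mul_gradL (hσ : ∀ i j, ContDiffOn ℝ 1 (σ i j) {0}ᶜ) {F g : E N → ℝ}
    {x : E N} (hx : x ≠ 0) (hF : DifferentiableAt ℝ F x) (hg : ContDiffOn ℝ 2 g {0}ᶜ) :
    ∑ i, ∑ j, pderiv j (fun y => F y * (σ i j y * gradL σ g y i)) x
      = F x * opL σ g x + inner ℝ (gradL σ F x) (gradL σ g x) := by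
  have hin : inner ℝ (gradL σ F x) (gradL σ g x)
      = ∑ i, ∑ j, σ i j x * gradL σ g x i * pderiv j F x := by
    rw [PiLp.inner_apply]
    refine Finset.sum_congr rfl fun i _ => ?_
    rw [gradL_apply F]
    simp only [RCLike.inner_apply, conj_trivial, Finset.mul_sum]
    exact Finset.sum_congr rfl fun j _ => by ring
  rw [hin, opL_eq_sum, Finset.mul_sum, ← Finset.sum_add_distrib]
  refine Finset.sum_congr rfl fun i _ => ?_
  rw [Finset.mul_sum, ← Finset.sum_add_distrib]
  refine Finset.sum_congr rfl fun j _ => pderiv_mul hF ?_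
  exact (differentiableAt_of_contDiffOn (hσ i j) one_ne_zero hx).mul
    (differentiableAt_of_contDiffOn (contDiffOn_gradL_apply hσ hg i) one_ne_zero hx)

lemma opL_comp (hσ : ∀ i j, ContDiffOn ℝ 1 (σ i j) {0}ᶜ) {g : E N → ℝ}
    (hg : ContDiffOn ℝ 2 g {0}ᶜ) {φ φ' : ℝ → ℝ} {φ'' : ℝ} {x : E N} (hx : x ≠ 0)
    (hφ : ∀ y ≠ 0, HasDerivAt φ (φ' (g y)) (g y)) (hφ' : HasDerivAt φ' φ'' (g x)) :
    opL σ (fun y => φ (g y)) x = φ' (g x) * opL σ g x + φ'' * ‖gradL σ g x‖ ^ 2 := by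
  have hgx : ∀ y ≠ 0, DifferentiableAt ℝ g y :=
    fun y hy => differentiableAt_of_contDiffOn hg two_ne_zero hy
  have hF : DifferentiableAt ℝ (fun y => φ' (g y)) x :=
    hφ'.differentiableAt.comp x (hgx x hx)
  have h1 := sum_pderiv_mul_gradL hσ hx hF hg
  rw [gradL_comp hφ' (hgx x hx), real_inner_smul_left, real_inner_self_eq_norm_sq] at h1
  rw [← h1, opL_eq_sum]
  refine Finset.sum_congr rfl fun i _ => Finset.sum_congr rfl fun j _ => pderiv_congr ?_
  filter_upwards [punctured_mem_nhds hx] with y hy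
  rw [gradL_comp (hφ y hy) (hgx y hy)]
  simp only [PiLp.smul_apply, smul_eq_mul]
  ring

/-! ### Functions supported away from the origin -/

lemma continuous_of_continuousOn_punctured {X : Type*} [TopologicalSpace X] [Zero X]
    {f : E N → X} (hf : ContinuousOn f {0}ᶜ) (hs : tsupport f ⊆ {0}ᶜ) : Continuous f :=
  continuous_of_tsupport fun _ hx => hf.continuousAt (punctured_mem_nhds (hs hx))

lemma contDiff_of_contDiffOn_punctured {f : E N → ℝ} {n : WithTop ℕ∞}
    (hf : ContDiffOn ℝ n f {0}ᶜ) (hs : tsupport f ⊆ {0}ᶜ) : ContDiff ℝ n f :=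
  contDiff_iff_contDiffAt.2 fun x => by
    by_cases hx : x ∈ tsupport f
    · exact hf.contDiffAt (punctured_mem_nhds (hs hx))
    · exact contDiffAt_const.congr_of_eventuallyEq (notMem_tsupport_iff_eventuallyEq.1 hx)

lemma tsupport_subset_of_eq_zero {X : Type*} [Zero X] {F : E N → ℝ} {f : E N → X}
    (hf : ∀ x, x ∉ tsupport F → f x = 0) : tsupport f ⊆ tsupport F :=
  closure_minimal (fun x hx => by_contra fun h => hx (hf x h)) (isClosed_tsupport F)

lemma integrable_of_eq_zero_off_tsupport {F f : E N → ℝ} (hF : HasCompactSupport F)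
    (hs : tsupport F ⊆ {0}ᶜ) (hf : ContinuousOn f {0}ᶜ) (h0 : ∀ x, x ∉ tsupport F → f x = 0) :
    Integrable f := by
  have hsub := tsupport_subset_of_eq_zero h0
  exact (continuous_of_continuousOn_punctured hf (hsub.trans hs)).integrable_of_hasCompactSupport
    (hF.of_isClosed_subset (isClosed_tsupport f) hsub)

lemma eventually_eq_zero_of_notMem_tsupport {F : E N → ℝ} {x : E N} (hx : x ∉ tsupport F) :
    F =ᶠ[𝓝 x] fun _ => 0 :=
  notMem_tsupport_iff_eventuallyEq.1 hx

lemma gradL_eq_zero_of_notMem_tsupport {F : E N → ℝ} {x : E N} (hx : x ∉ tsupport F) :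
    gradL σ F x = 0 :=
  (gradL_congr (eventually_eq_zero_of_notMem_tsupport hx)).trans (gradL_zero x)

lemma opL_eq_zero_of_notMem_tsupport {F : E N → ℝ} {x : E N} (hx : x ∉ tsupport F) :
    opL σ F x = 0 :=
  (opL_congr (eventually_eq_zero_of_notMem_tsupport hx)).trans (opL_zero x)

/-! ### Green's formula -/

lemma integrable_pderiv {H : E N → ℝ} (hH : ContDiff ℝ 1 H) (hc : HasCompactSupport H)
    (j : Fin N) : Integrable (pderiv j H) := by
  refine ((hH.continuous_fderiv one_ne_zero).clm_apply continuous_const).integrable_of_hasCompactSupport ?_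
  exact hc.fderiv_apply ℝ _

lemma integral_pderiv_eq_zero {H : E N → ℝ} (hH : ContDiff ℝ 1 H) (hc : HasCompactSupport H)
    (j : Fin N) : ∫ x, pderiv j H x = 0 := by
  have hi : Integrable (fun x => fderiv ℝ H x (EuclideanSpace.single j 1))
      (volume : Measure (E N)) := integrable_pderiv hH hc j
  have := integral_mul_fderiv_eq_neg_fderiv_mul_of_integrable (μ := (volume : Measure (E N)))
    (f := fun _ => (1 : ℝ)) (g := H) (v := EuclideanSpace.single j 1)
    (by simp) (by simpa using hi)
    (by simpa using hH.continuous.integrable_of_hasCompactSupport hc) (by simp)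
    (fun x _ => hH.differentiable one_ne_zero x)
  simpa [pderiv] using this

lemma integrable_green (hσ : ∀ i j, ContDiffOn ℝ 1 (σ i j) {0}ᶜ) {F g : E N → ℝ}
    (hF : ContDiffOn ℝ 1 F {0}ᶜ) (hc : HasCompactSupport F) (hs : tsupport F ⊆ {0}ᶜ)
    (hg : ContDiffOn ℝ 2 g {0}ᶜ) :
    Integrable (fun x => F x * opL σ g x + inner ℝ (gradL σ F x) (gradL σ g x)) := by
  refine integrable_of_eq_zero_off_tsupport hc hs ?_ fun x hx => ?_
  · exact (hF.continuousOn.mul (continuousOn_opL hσ hg)).add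
      ((continuousOn_gradL hσ hF).inner (continuousOn_gradL hσ (hg.of_le one_le_two)))
  · rw [gradL_eq_zero_of_notMem_tsupport hx, image_eq_zero_of_notMem_tsupport hx]
    simp

/-- Green's formula for the operator `L` on the punctured space. -/
theorem integral_green (hσ : ∀ i j, ContDiffOn ℝ 1 (σ i j) {0}ᶜ) {F g : E N → ℝ}
    (hF : ContDiffOn ℝ 1 F {0}ᶜ) (hc : HasCompactSupport F) (hs : tsupport F ⊆ {0}ᶜ)
    (hg : ContDiffOn ℝ 2 g {0}ᶜ) :
    ∫ x, (F x * opL σ g x + inner ℝ (gradL σ F x) (gradL σ g x)) = 0 := by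
  have h0 : ∀ i j x, x ∉ tsupport F → F x * (σ i j x * gradL σ g x i) = 0 := fun i j x hx => by
    rw [image_eq_zero_of_notMem_tsupport hx, zero_mul]
  have hsub : ∀ i j, tsupport (fun y => F y * (σ i j y * gradL σ g y i)) ⊆ tsupport F :=
    fun i j => tsupport_subset_of_eq_zero (h0 i j)
  have hH : ∀ i j, ContDiff ℝ 1 (fun y => F y * (σ i j y * gradL σ g y i)) := fun i j =>
    contDiff_of_contDiffOn_punctured (hF.mul ((hσ i j).mul (contDiffOn_gradL_apply hσ hg i)))
      ((hsub i j).trans hs)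
  have hHc : ∀ i j, HasCompactSupport (fun y => F y * (σ i j y * gradL σ g y i)) := fun i j =>
    hc.of_isClosed_subset (isClosed_tsupport _) (hsub i j)
  calc ∫ x, (F x * opL σ g x + inner ℝ (gradL σ F x) (gradL σ g x))
      = ∫ x, ∑ i, ∑ j, pderiv j (fun y => F y * (σ i j y * gradL σ g y i)) x := by
        refine integral_congr_ae (Eventually.of_forall fun x => ?_)
        by_cases hx : x ∈ tsupport F
        · exact (sum_pderiv_mul_gradL hσ (hs hx)
            (differentiableAt_of_contDiffOn hF one_ne_zero (hs hx)) hg).symm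
        · simp only
          rw [gradL_eq_zero_of_notMem_tsupport hx, image_eq_zero_of_notMem_tsupport hx]
          symm
          simp only [zero_mul, inner_zero_left, add_zero]
          refine Finset.sum_eq_zero fun i _ => Finset.sum_eq_zero fun j _ => ?_
          have : (fun y => F y * (σ i j y * gradL σ g y i)) =ᶠ[𝓝 x] fun _ => 0 := by
            filter_upwards [eventually_eq_zero_of_notMem_tsupport hx] with y hy
            rw [hy, zero_mul]
          rw [pderiv_congr this]
          simp [pderiv]
    _ = ∑ i, ∑ j, ∫ x, pderiv j (fun y => F y * (σ i j y * gradL σ g y i)) x := by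
        rw [integral_finsetSum _ fun i _ =>
          integrable_finsetSum _ fun j _ => integrable_pderiv (hH i j) (hHc i j) j]
        exact Finset.sum_congr rfl fun i _ =>
          integral_finsetSum _ fun j _ => integrable_pderiv (hH i j) (hHc i j) j
    _ = 0 := Finset.sum_eq_zero fun i _ => Finset.sum_eq_zero fun j _ =>
        integral_pderiv_eq_zero (hH i j) (hHc i j) j

end Calculus

end Rellich

namespace Rellich

/-! ### Derivatives and convexity of real powers -/

section Powers

lemma hasDerivAt_abs_rpow_mul_self {p : ℝ} (hp : 2 ≤ p) (t : ℝ) :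
    HasDerivAt (fun t : ℝ => |t| ^ (p - 2) * t) ((p - 1) * |t| ^ (p - 2)) t := by
  rcases eq_or_ne t 0 with rfl | ht
  · rw [hasDerivAt_iff_tendsto_slope]
    have hcont : Tendsto (fun t : ℝ => |t| ^ (p - 2)) (𝓝[≠] 0) (𝓝 (|0| ^ (p - 2))) :=
      ((continuous_abs.rpow_const fun _ => Or.inr (by linarith)).tendsto 0).mono_left
        nhdsWithin_le_nhds
    -- The slope at zero is `|t|^{p-2}`. For `p = 2` both sides are `0 ^ 0 = 1`; for `p > 2` both
    -- vanish.
    have hval : (p - 1) * |(0 : ℝ)| ^ (p - 2) = |(0 : ℝ)| ^ (p - 2) := by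
      rcases eq_or_lt_of_le hp with rfl | hp'
      · norm_num
      · rw [abs_zero, Real.zero_rpow (by linarith), mul_zero]
    rw [hval]
    refine hcont.congr' ?_
    filter_upwards [self_mem_nhdsWithin] with t ht
    have ht' : t ≠ 0 := ht
    rw [slope_def_field]
    field_simp
    ring
  · have habs : HasDerivAt (fun t : ℝ => |t| ^ (p - 2))
        (SignType.sign t * (p - 2) * |t| ^ (p - 2 - 1)) t := by
      have := (hasDerivAt_abs ht).rpow_const (p := p - 2) (Or.inl (abs_ne_zero.2 ht))
      simpa [mul_assoc] using this
    refine (habs.mul (hasDerivAt_id t)).congr_deriv ?_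
    have h1 : |t| ^ (p - 2 - 1) * |t| = |t| ^ (p - 2) := by
      rw [Real.rpow_sub_one (abs_ne_zero.2 ht), div_mul_cancel₀ _ (abs_ne_zero.2 ht)]
    have h2 : (SignType.sign t : ℝ) * t = |t| := sign_mul_self t
    simp only [id]
    linear_combination (p - 2) * |t| ^ (p - 2 - 1) * h2 + (p - 2) * h1

lemma continuous_abs_rpow {q : ℝ} (hq : 0 ≤ q) : Continuous fun t : ℝ => |t| ^ q :=
  continuous_abs.rpow_const fun _ => Or.inr hq

lemma contDiff_abs_rpow_mul_self {p : ℝ} (hp : 2 ≤ p) :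
    ContDiff ℝ 1 (fun t : ℝ => |t| ^ (p - 2) * t) := by
  rw [contDiff_one_iff_deriv]
  refine ⟨fun t => (hasDerivAt_abs_rpow_mul_self hp t).differentiableAt, ?_⟩
  have : deriv (fun t : ℝ => |t| ^ (p - 2) * t) = fun t => (p - 1) * |t| ^ (p - 2) :=
    funext fun t => (hasDerivAt_abs_rpow_mul_self hp t).deriv
  rw [this]
  exact continuous_const.mul (continuous_abs_rpow (by linarith))

lemma contDiff_abs_rpow {p : ℝ} (hp : 2 ≤ p) : ContDiff ℝ 1 (fun t : ℝ => |t| ^ p) := by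
  rw [contDiff_one_iff_deriv]
  refine ⟨fun t => (hasDerivAt_abs_rpow t (by linarith)).differentiableAt, ?_⟩
  have : deriv (fun t : ℝ => |t| ^ p) = fun t => p * |t| ^ (p - 2) * t :=
    funext fun t => (hasDerivAt_abs_rpow t (by linarith)).deriv
  rw [this]
  exact (continuous_const.mul (continuous_abs_rpow (by linarith))).mul continuous_id

lemma abs_rpow_eq_mul_sq {p : ℝ} (hp : 2 ≤ p) (t : ℝ) : |t| ^ p = |t| ^ (p - 2) * t ^ 2 := by
  rw [← sq_abs, ← Real.rpow_natCast, ← Real.rpow_add_of_nonneg (abs_nonneg t) (by linarith)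
    (by norm_num)]
  norm_num

/-- The convex function `|t| ^ p` lies above its tangents. -/
lemma abs_rpow_add_le {p : ℝ} (hp : 2 ≤ p) (x y : ℝ) :
    |x| ^ p + p * (|x| ^ (p - 2) * x) * (y - x) ≤ |y| ^ p := by
  have hp0 : 0 < p := by linarith
  have hpq := Real.HolderConjugate.conjExponent (show 1 < p by linarith)
  -- Young's inequality for `y` and `|x|^{p-2} x`, whose conjugate power is `|x|^p`, is the tangent
  -- inequality after multiplication by `p`.
  have hY := Real.young_inequality y (|x| ^ (p - 2) * x) hpq
  have habs : |(|x| ^ (p - 2) * x)| = |x| ^ (p - 1) := by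
    rw [abs_mul, abs_of_nonneg (Real.rpow_nonneg (abs_nonneg x) _)]
    rcases eq_or_ne x 0 with rfl | hx
    · rw [abs_zero, mul_zero, Real.zero_rpow (by linarith)]
    · rw [← Real.rpow_add_one (abs_ne_zero.2 hx)]
      congr 1
      ring
  have hq : |(|x| ^ (p - 2) * x)| ^ p.conjExponent = |x| ^ p := by
    rw [habs, ← Real.rpow_mul (abs_nonneg x)]
    congr 1
    rw [Real.conjExponent]
    field_simp [show p - 1 ≠ 0 by linarith]
  rw [hq] at hY
  have hinv : |x| ^ p / p.conjExponent = |x| ^ p * (p - 1) / p := by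
    rw [Real.conjExponent]
    field_simp [show p - 1 ≠ 0 by linarith]
  rw [hinv] at hY
  have hY' : p * (y * (|x| ^ (p - 2) * x)) ≤ |y| ^ p + |x| ^ p * (p - 1) := by
    have := mul_le_mul_of_nonneg_left hY hp0.le
    calc _ ≤ _ := this
      _ = _ := by field_simp
  have h2 := abs_rpow_eq_mul_sq hp x
  nlinarith [h2, hY']

end Powers

/-- The assumptions on the vector fields and on the function `d`. -/
structure IsPotential {N h : ℕ} (σ : Fin h → Fin N → E N → ℝ) (d : E N → ℝ) (β : ℝ) : Prop where
  contDiffOn_coeff : ∀ i j, ContDiffOn ℝ 1 (σ i j) {0}ᶜ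
  contDiffOn : ContDiffOn ℝ ∞ d {0}ᶜ
  pos : ∀ x, x ≠ 0 → 0 < d x
  gradL_ne_zero : ∀ᵐ x : E N, gradL σ d x ≠ 0
  opL_eq : ∀ x, x ≠ 0 → opL σ d x = (1 - β) * ‖gradL σ d x‖ ^ 2 / d x

/-- The integrand `|u|^{p-2} u L u d^{-s}`. -/
noncomputable def crossDensity {N h : ℕ} (σ : Fin h → Fin N → E N → ℝ) (d : E N → ℝ) (p s : ℝ)
    (u : E N → ℝ) (x : E N) : ℝ :=
  |u x| ^ (p - 2) * u x * d x ^ (-s) * opL σ u x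

/-- The remainder `|u|^{p-2} d^{-s} |∇_L u - γ (u / d) ∇_L d|^2`. -/
noncomputable def remDensity {N h : ℕ} (σ : Fin h → Fin N → E N → ℝ) (d : E N → ℝ) (p s γ : ℝ)
    (u : E N → ℝ) (x : E N) : ℝ :=
  |u x| ^ (p - 2) * d x ^ (-s) * ‖gradL σ u x - (γ * u x / d x) • gradL σ d x‖ ^ 2

/-! ### The remainder identity and the lower bound of the deficit -/

section Inequality

variable {N h : ℕ} {σ : Fin h → Fin N → E N → ℝ} {d : E N → ℝ} {β p θ s γ : ℝ} {u : E N → ℝ}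

lemma IsTest.contDiffOn (hu : IsTest u) {n : WithTop ℕ∞} (hn : n ≤ ∞) : ContDiffOn ℝ n u {0}ᶜ :=
  (hu.smooth.of_le hn).contDiffOn

lemma IsTest.contDiffOn_two (hu : IsTest u) : ContDiffOn ℝ 2 u {0}ᶜ :=
  hu.contDiffOn (WithTop.coe_le_coe.2 (le_top : (2 : ℕ∞) ≤ ⊤))

lemma IsTest.contDiffOn_one (hu : IsTest u) : ContDiffOn ℝ 1 u {0}ᶜ :=
  hu.contDiffOn_two.of_le one_le_two

lemma IsPotential.contDiffOn_two (hd : IsPotential σ d β) : ContDiffOn ℝ 2 d {0}ᶜ :=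
  hd.contDiffOn.of_le (WithTop.coe_le_coe.2 (le_top : (2 : ℕ∞) ≤ ⊤))

lemma IsPotential.contDiffOn_one (hd : IsPotential σ d β) : ContDiffOn ℝ 1 d {0}ᶜ :=
  hd.contDiffOn_two.of_le one_le_two

lemma IsPotential.contDiffOn_rpow (hd : IsPotential σ d β) (a : ℝ) :
    ContDiffOn ℝ ∞ (fun x => d x ^ a) {0}ᶜ :=
  fun x hx => (hd.contDiffOn x hx).rpow_const_of_ne (hd.pos x hx).ne'

lemma IsPotential.differentiableAt (hd : IsPotential σ d β) {x : E N} (hx : x ≠ 0) :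
    DifferentiableAt ℝ d x :=
  differentiableAt_of_contDiffOn hd.contDiffOn_one one_ne_zero hx

lemma IsPotential.gradL_rpow (hd : IsPotential σ d β) (a : ℝ) {x : E N} (hx : x ≠ 0) :
    gradL σ (fun y => d y ^ a) x = (a * d x ^ (a - 1)) • gradL σ d x :=
  gradL_comp (φ := fun t => t ^ a) (Real.hasDerivAt_rpow_const (Or.inl (hd.pos x hx).ne'))
    (hd.differentiableAt hx)

lemma IsPotential.continuousOn_gradL (hd : IsPotential σ d β) :
    ContinuousOn (gradL σ d) {0}ᶜ :=
  Rellich.continuousOn_gradL hd.contDiffOn_coeff hd.contDiffOn_one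

lemma continuousOn_lowDensity (hd : IsPotential σ d β) (hp : 2 ≤ p)
    (hu : ContinuousOn u {0}ᶜ) : ContinuousOn (lowDensity σ d p θ u) {0}ᶜ := by
  refine ContinuousOn.mul (ContinuousOn.div ?_ (hd.contDiffOn_rpow _).continuousOn
    fun x hx => (Real.rpow_pos_of_pos (hd.pos x hx) _).ne') (hd.continuousOn_gradL.norm.pow 2)
  exact (continuous_abs_rpow (by linarith)).comp_continuousOn hu

lemma continuousOn_crossDensity (hd : IsPotential σ d β) (hp : 2 ≤ p)
    (hu : ContDiffOn ℝ 2 u {0}ᶜ) : ContinuousOn (crossDensity σ d p s u) {0}ᶜ := by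
  have h1 : ContinuousOn (fun x => |u x| ^ (p - 2)) {0}ᶜ :=
    (continuous_abs_rpow (by linarith)).comp_continuousOn hu.continuousOn
  exact ((h1.mul hu.continuousOn).mul (hd.contDiffOn_rpow _).continuousOn).mul
    (continuousOn_opL hd.contDiffOn_coeff hu)

lemma continuousOn_remDensity (hd : IsPotential σ d β) (hp : 2 ≤ p)
    (hu : ContDiffOn ℝ 2 u {0}ᶜ) : ContinuousOn (remDensity σ d p s γ u) {0}ᶜ := by
  have h1 : ContinuousOn (fun x => |u x| ^ (p - 2)) {0}ᶜ :=
    (continuous_abs_rpow (by linarith)).comp_continuousOn hu.continuousOn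
  have h2 : ContinuousOn (fun x => γ * u x / d x) {0}ᶜ :=
    (continuousOn_const.mul hu.continuousOn).div hd.contDiffOn.continuousOn
      fun x hx => (hd.pos x hx).ne'
  have h3 := (Rellich.continuousOn_gradL hd.contDiffOn_coeff (hu.of_le one_le_two)).sub
    (h2.smul hd.continuousOn_gradL)
  exact (h1.mul (hd.contDiffOn_rpow _).continuousOn).mul (h3.norm.pow 2)

lemma lowDensity_eq_zero (hp : 2 ≤ p) {x : E N} (hx : u x = 0) :
    lowDensity σ d p θ u x = 0 := by
  simp [lowDensity, hx, Real.zero_rpow (show p ≠ 0 by linarith)]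

lemma integrable_lowDensity (hd : IsPotential σ d β) (hp : 2 ≤ p) (hu : IsTest u) :
    Integrable (lowDensity σ d p θ u) :=
  integrable_of_eq_zero_off_tsupport hu.compact hu.support
    (continuousOn_lowDensity hd hp hu.smooth.continuous.continuousOn)
    fun _ hx => lowDensity_eq_zero hp (image_eq_zero_of_notMem_tsupport hx)

lemma integrable_crossDensity (hd : IsPotential σ d β) (hp : 2 ≤ p) (hu : IsTest u) :
    Integrable (crossDensity σ d p s u) :=
  integrable_of_eq_zero_off_tsupport hu.compact hu.support
    (continuousOn_crossDensity hd hp hu.contDiffOn_two)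
    fun x hx => by simp [crossDensity, image_eq_zero_of_notMem_tsupport hx]

lemma integrable_remDensity (hd : IsPotential σ d β) (hp : 2 ≤ p) (hu : IsTest u) :
    Integrable (remDensity σ d p s γ u) :=
  integrable_of_eq_zero_off_tsupport hu.compact hu.support
    (continuousOn_remDensity hd hp hu.contDiffOn_two)
    fun x hx => by
      simp [remDensity, image_eq_zero_of_notMem_tsupport hx, gradL_eq_zero_of_notMem_tsupport hx]

lemma highDensity_eq_zero (hp : 2 ≤ p) {x : E N} (hx : opL σ u x = 0) :
    highDensity σ d p θ u x = 0 := by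
  simp [highDensity, hx, Real.zero_rpow (show p ≠ 0 by linarith)]

/-- The weight may be singular where `∇_L d` vanishes, so continuity does not suffice here as it
does for the other densities. Local integrability of the weight is multiplied by `|L u|^p`, which is
continuous with compact support. -/
lemma integrable_highDensity (hd : IsPotential σ d β) (hp : 2 ≤ p)
    (hloc : LocallyIntegrableOn
      (fun x => d x ^ (-(p * θ)) * ‖gradL σ d x‖ ^ (-(2 * (p - 1)))) {0}ᶜ)
    (hu : IsTest u) : Integrable (highDensity σ d p θ u) := by
  have hK : IsCompact (tsupport u) := hu.compact
  have h1 : IntegrableOn (fun x => |opL σ u x| ^ p *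
      (d x ^ (-(p * θ)) * ‖gradL σ d x‖ ^ (-(2 * (p - 1))))) (tsupport u) := by
    refine (hloc.integrableOn_compact_subset hu.support hK).continuousOn_mul ?_ hK
    exact (continuous_abs_rpow (by linarith)).comp_continuousOn
      ((continuousOn_opL hd.contDiffOn_coeff hu.contDiffOn_two).mono hu.support)
  have h2 : IntegrableOn (highDensity σ d p θ u) (tsupport u) := by
    refine h1.congr_fun (fun x hx => ?_) hK.measurableSet
    simp only [highDensity]
    rw [Real.rpow_neg (hd.pos x (hu.support hx)).le, Real.rpow_neg (norm_nonneg _), ← mul_inv,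
      div_eq_mul_inv]
  refine (integrableOn_iff_integrable_of_support_subset fun x hx => ?_).1 h2
  by_contra hx'
  exact hx (highDensity_eq_zero hp (opL_eq_zero_of_notMem_tsupport hx'))

/-- Since `p(θ + 2) = s + 2`, this density carries the same power of `d` as the other terms of the
identity. -/
lemma lowDensity_eq (hd : IsPotential σ d β) (hp : 2 ≤ p) (hs : s = p * θ + 2 * p - 2)
    {x : E N} (hx : x ≠ 0) :
    lowDensity σ d p θ u x
      = |u x| ^ (p - 2) * u x ^ 2 * (d x ^ (-s) / d x ^ 2) * ‖gradL σ d x‖ ^ 2 := by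
  have hD := hd.pos x hx
  have : d x ^ (p * (θ + 2)) = d x ^ s * d x ^ 2 := by
    rw [← Real.rpow_natCast (d x) 2, ← Real.rpow_add hD]
    congr 1
    push_cast
    rw [hs]; ring
  rw [lowDensity, this, abs_rpow_eq_mul_sq hp, Real.rpow_neg hD.le]
  field_simp

/-- The pointwise identity behind the remainder formula: the combination of densities is a
divergence. -/
lemma density_identity (hd : IsPotential σ d β) (hp : 2 ≤ p) (hs : s = p * θ + 2 * p - 2)
    (hγ : p * γ = β + s) (hu : ContDiffOn ℝ 2 u {0}ᶜ) {x : E N} (hx : x ≠ 0) :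
    (p - 1) * remDensity σ d p s γ u x + γ * (β - γ) * lowDensity σ d p θ u x
        + crossDensity σ d p s u x
      = (|u x| ^ (p - 2) * u x * d x ^ (-s) * opL σ u x
          + inner ℝ (gradL σ (fun y => |u y| ^ (p - 2) * u y * d y ^ (-s)) x) (gradL σ u x))
        + (s - 2 * γ * (p - 1)) / p * (|u x| ^ p * d x ^ (-s - 1) * opL σ d x
          + inner ℝ (gradL σ (fun y => |u y| ^ p * d y ^ (-s - 1)) x) (gradL σ d x)) := by
  have hp0 : p ≠ 0 := by linarith
  have hD := hd.pos x hx
  have hux : DifferentiableAt ℝ u x := differentiableAt_of_contDiffOn hu two_ne_zero hx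
  have hda : ∀ a : ℝ, DifferentiableAt ℝ (fun y => d y ^ a) x := fun a =>
    differentiableAt_of_contDiffOn (hd.contDiffOn_rpow a) (by simp) hx
  have hφ1 := hasDerivAt_abs_rpow_mul_self hp (u x)
  have hφ2 := hasDerivAt_abs_rpow (u x) (show 1 < p by linarith)
  have e1 := gradL_mul (σ := σ) (hφ1.differentiableAt.comp x hux) (hda (-s))
  have e2 := gradL_mul (σ := σ) (hφ2.differentiableAt.comp x hux) (hda (-s - 1))
  simp only [Function.comp_def] at e1 e2
  rw [gradL_comp hφ1 hux, hd.gradL_rpow _ hx] at e1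
  rw [gradL_comp hφ2 hux, hd.gradL_rpow _ hx] at e2
  rw [e1, e2, hd.opL_eq x hx, lowDensity_eq hd hp hs hx, abs_rpow_eq_mul_sq hp (u x)]
  simp only [remDensity, crossDensity, inner_add_left, real_inner_smul_left,
    real_inner_self_eq_norm_sq, norm_sub_sq_real, norm_smul, real_inner_smul_right, mul_pow,
    Real.norm_eq_abs, sq_abs, real_inner_comm (gradL σ u x) (gradL σ d x),
    Real.rpow_sub_one hD.ne']
  -- The factor `(s - 2γ(p-1))/p` of the second divergence is the one that matches the mixed terms
  -- `⟨∇_L u, ∇_L d⟩`. The terms in `|∇_L d|²` then agree exactly because `pγ = β + s`.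
  have hβ : β = p * γ - s := by linarith
  subst hβ
  field_simp
  ring

theorem integral_remDensity (hd : IsPotential σ d β) (hp : 2 ≤ p) (hs : s = p * θ + 2 * p - 2)
    (hγ : p * γ = β + s) (hu : IsTest u) :
    (p - 1) * (∫ x, remDensity σ d p s γ u x) + γ * (β - γ) * (∫ x, lowDensity σ d p θ u x)
      + ∫ x, crossDensity σ d p s u x = 0 := by
  set F₁ : E N → ℝ := fun y => |u y| ^ (p - 2) * u y * d y ^ (-s) with hF₁
  set F₂ : E N → ℝ := fun y => |u y| ^ p * d y ^ (-s - 1) with hF₂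
  have z₁ : ∀ x, x ∉ tsupport u → F₁ x = 0 := fun x hx => by
    simp [hF₁, image_eq_zero_of_notMem_tsupport hx]
  have z₂ : ∀ x, x ∉ tsupport u → F₂ x = 0 := fun x hx => by
    simp [hF₂, image_eq_zero_of_notMem_tsupport hx, Real.zero_rpow (show p ≠ 0 by linarith)]
  have t₁ := tsupport_subset_of_eq_zero z₁
  have t₂ := tsupport_subset_of_eq_zero z₂
  have k₁ := hu.compact.of_isClosed_subset (isClosed_tsupport F₁) t₁
  have k₂ := hu.compact.of_isClosed_subset (isClosed_tsupport F₂) t₂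
  have c₁ : ContDiffOn ℝ 1 F₁ {0}ᶜ := ((contDiff_abs_rpow_mul_self hp).comp_contDiffOn
    hu.contDiffOn_one).mul ((hd.contDiffOn_rpow _).of_le (by exact_mod_cast (le_top : (1 : ℕ∞) ≤ ⊤)))
  have c₂ : ContDiffOn ℝ 1 F₂ {0}ᶜ := ((contDiff_abs_rpow hp).comp_contDiffOn
    hu.contDiffOn_one).mul ((hd.contDiffOn_rpow _).of_le (by exact_mod_cast (le_top : (1 : ℕ∞) ≤ ⊤)))
  have g₁ := integral_green hd.contDiffOn_coeff c₁ k₁ (t₁.trans hu.support) hu.contDiffOn_two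
  have g₂ := integral_green hd.contDiffOn_coeff c₂ k₂ (t₂.trans hu.support) hd.contDiffOn_two
  have i₁ := integrable_green hd.contDiffOn_coeff c₁ k₁ (t₁.trans hu.support) hu.contDiffOn_two
  have i₂ := integrable_green hd.contDiffOn_coeff c₂ k₂ (t₂.trans hu.support) hd.contDiffOn_two
  have hr := integrable_remDensity (s := s) (γ := γ) hd hp hu
  have hl := integrable_lowDensity (θ := θ) hd hp hu
  have hc := integrable_crossDensity (s := s) hd hp hu
  have hr' : Integrable fun x => (p - 1) * remDensity σ d p s γ u x := hr.const_mul _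
  have hl' : Integrable fun x => γ * (β - γ) * lowDensity σ d p θ u x := hl.const_mul _
  have hrl : Integrable fun x => (p - 1) * remDensity σ d p s γ u x
    + γ * (β - γ) * lowDensity σ d p θ u x := hr'.add hl'
  rw [← integral_const_mul, ← integral_const_mul, ← integral_add hr' hl', ← integral_add hrl hc]
  calc _ = ∫ x, ((F₁ x * opL σ u x + inner ℝ (gradL σ F₁ x) (gradL σ u x))
        + (s - 2 * γ * (p - 1)) / p * (F₂ x * opL σ d x
          + inner ℝ (gradL σ F₂ x) (gradL σ d x))) := by
        refine integral_congr_ae (Eventually.of_forall fun x => ?_)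
        by_cases hx : x ∈ tsupport u
        · exact density_identity hd hp hs hγ hu.contDiffOn_two (hu.support hx)
        · simp only
          rw [gradL_eq_zero_of_notMem_tsupport fun h => hx (t₁ h),
            gradL_eq_zero_of_notMem_tsupport (F := F₂) fun h => hx (t₂ h), z₁ x hx, z₂ x hx,
            lowDensity_eq_zero hp (image_eq_zero_of_notMem_tsupport hx)]
          simp [remDensity, crossDensity, image_eq_zero_of_notMem_tsupport hx,
            gradL_eq_zero_of_notMem_tsupport hx]
    _ = 0 := by
        rw [integral_add i₁ (i₂.const_mul _), integral_const_mul, g₁, g₂]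
        simp

/-- The two factors in the numerator of the constant are `-pγ` and `p(γ - β)`. -/
lemma const_eq (hp : 2 ≤ p) (hs : s = p * θ + 2 * p - 2) (hγ : p * γ = β + s) :
    const β p θ = γ * (β - γ) := by
  have hp0 : p ≠ 0 := by linarith
  have hβ : β = p * γ - s := by linarith
  rw [const, hβ, hs]
  field_simp
  ring

/-- With `X = -d² |∇_L d|^{-2} L u` and the common weight `W = d^{-s-2} |∇_L d|²`, the three
densities are `|u|^p W`, `-|u|^{p-2} u X W` and `|X|^p W`. The claim is the tangent inequality for
`|·|^p` at `C u`, evaluated at `X`. -/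
lemma highDensity_ge (hd : IsPotential σ d β) (hp : 2 ≤ p) (hs : s = p * θ + 2 * p - 2)
    {C : ℝ} (hC : 0 ≤ C) {x : E N} (hx : x ≠ 0) (hg : gradL σ d x ≠ 0) :
    C ^ p * lowDensity σ d p θ u x
      + p * C ^ (p - 1) * (-crossDensity σ d p s u x - C * lowDensity σ d p θ u x)
      ≤ highDensity σ d p θ u x := by
  have hD := hd.pos x hx
  have hG : 0 < ‖gradL σ d x‖ := norm_pos_iff.2 hg
  set D := d x
  set G := ‖gradL σ d x‖
  set X := -opL σ u x * D ^ 2 / G ^ 2 with hX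
  set W := D ^ (-s) / D ^ 2 * G ^ 2 with hW
  have hW0 : 0 < W := by positivity
  have hlow : lowDensity σ d p θ u x = |u x| ^ p * W := by
    rw [lowDensity_eq hd hp hs hx, abs_rpow_eq_mul_sq hp]; ring
  have hcross : -crossDensity σ d p s u x = |u x| ^ (p - 2) * u x * X * W := by
    change -(|u x| ^ (p - 2) * u x * D ^ (-s) * opL σ u x) = _
    rw [hX, hW]
    field_simp
  have hhigh : highDensity σ d p θ u x = |X| ^ p * W := by
    have e1 : |X| = |opL σ u x| * D ^ (2 : ℝ) * G ^ (-2 : ℝ) := by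
      rw [hX, abs_div, abs_mul, abs_neg, abs_of_pos (show 0 < D ^ 2 by positivity),
        abs_of_pos (show 0 < G ^ 2 by positivity), Real.rpow_neg hG.le]
      norm_cast
    have e2 : W = D ^ (-s - 2) * G ^ (2 : ℝ) := by
      rw [hW, Real.rpow_sub hD]; norm_cast
    rw [e1, e2, Real.mul_rpow (by positivity) (by positivity),
      Real.mul_rpow (by positivity) (by positivity), ← Real.rpow_mul hD.le, ← Real.rpow_mul hG.le,
      highDensity, div_eq_mul_inv, mul_inv, ← Real.rpow_neg hD.le, ← Real.rpow_neg hG.le]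
    calc _ = |opL σ u x| ^ p * (D ^ (2 * p + (-s - 2)) * G ^ (-2 * p + 2)) := by
          rw [hs]; congr 3 <;> ring
      _ = _ := by rw [Real.rpow_add hD, Real.rpow_add hG]; ring
  have hconv := abs_rpow_add_le hp (C * u x) X
  have hCp : |C * u x| ^ p = C ^ p * |u x| ^ p := by
    rw [abs_mul, abs_of_nonneg hC, Real.mul_rpow hC (abs_nonneg _)]
  have hCp' : |C * u x| ^ (p - 2) * (C * u x) = C ^ (p - 1) * (|u x| ^ (p - 2) * u x) := by
    rw [abs_mul, abs_of_nonneg hC, Real.mul_rpow hC (abs_nonneg _)]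
    -- `C = 0` is allowed here, since the exponent `p - 1` is not zero.
    have : C ^ (p - 1) = C ^ (p - 2) * C := by
      rw [show p - 1 = p - 2 + 1 by ring, Real.rpow_add_one' hC (by linarith)]
    rw [this]; ring
  rw [hCp, hCp'] at hconv
  have := mul_le_mul_of_nonneg_right hconv hW0.le
  rw [hlow, hcross, hhigh]
  refine le_trans (le_of_eq ?_) this
  rw [abs_rpow_eq_mul_sq hp (u x)]
  ring

/-- By the remainder identity, the first-order term of the tangent inequality integrates to `(p-1) ∫
R`. The deficit thus controls the remainder as soon as `C > 0`. -/
theorem deficit_ge (hd : IsPotential σ d β) (hp : 2 ≤ p) (hs : s = p * θ + 2 * p - 2)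
    (hγ : p * γ = β + s) (hC : 0 ≤ const β p θ) (hu : IsTest u)
    (hi : Integrable (highDensity σ d p θ u)) :
    p * const β p θ ^ (p - 1) * ((p - 1) * ∫ x, remDensity σ d p s γ u x)
      ≤ (∫ x, highDensity σ d p θ u x) - const β p θ ^ p * ∫ x, lowDensity σ d p θ u x := by
  have hid := integral_remDensity hd hp hs hγ hu
  rw [← const_eq hp hs hγ] at hid
  set C := const β p θ
  have hl := integrable_lowDensity (θ := θ) hd hp hu
  have hc := integrable_crossDensity (s := s) hd hp hu
  have hmono : ∫ x, (C ^ p * lowDensity σ d p θ u x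
      + p * C ^ (p - 1) * (-crossDensity σ d p s u x - C * lowDensity σ d p θ u x))
      ≤ ∫ x, highDensity σ d p θ u x := by
    refine integral_mono_ae ((hl.const_mul _).add ((hc.neg.sub (hl.const_mul _)).const_mul _)) hi ?_
    filter_upwards [hd.gradL_ne_zero] with x hg
    by_cases hx : x ∈ tsupport u
    · exact highDensity_ge hd hp hs hC (hu.support hx) hg
    · rw [lowDensity_eq_zero hp (image_eq_zero_of_notMem_tsupport hx),
        highDensity_eq_zero hp (opL_eq_zero_of_notMem_tsupport hx)]
      simp [crossDensity, image_eq_zero_of_notMem_tsupport hx]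
  have hc' : Integrable fun x => -crossDensity σ d p s u x := hc.neg
  have hl' : ∀ a : ℝ, Integrable fun x => a * lowDensity σ d p θ u x := fun a => hl.const_mul a
  have hcl : Integrable fun x => p * C ^ (p - 1) *
    (-crossDensity σ d p s u x - C * lowDensity σ d p θ u x) := (hc'.sub (hl' C)).const_mul _
  rw [integral_add (hl' _) hcl, integral_const_mul, integral_const_mul, integral_sub hc' (hl' C),
    integral_const_mul, integral_neg] at hmono
  have e : -(∫ x, crossDensity σ d p s u x) - C * ∫ x, lowDensity σ d p θ u x
      = (p - 1) * ∫ x, remDensity σ d p s γ u x := by linarith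
  rw [e] at hmono
  linarith

lemma remDensity_nonneg (hd : IsPotential σ d β) {x : E N} (hx : x ≠ 0) :
    0 ≤ remDensity σ d p s γ u x := by
  have := hd.pos x hx
  unfold remDensity
  positivity

end Inequality

end Rellich

namespace Rellich

/-! ### Strictness, and the form of maximizing functions -/

section Rigidity

variable {N h : ℕ} {σ : Fin h → Fin N → E N → ℝ} {d : E N → ℝ} {β p θ s γ : ℝ} {u v : E N → ℝ}

/-- Up to the factor `d^{-γ}`, the derivative of `d^{-γ} v` along the fields is the vector whose
square enters the remainder. -/
lemma IsPotential.gradL_weighted (hd : IsPotential σ d β) {x : E N} (hx : x ≠ 0)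
    (hv : DifferentiableAt ℝ v x) :
    gradL σ (fun y => d y ^ (-γ) * v y) x
      = d x ^ (-γ) • (gradL σ v x - (γ * v x / d x) • gradL σ d x) := by
  have hD := hd.pos x hx
  rw [gradL_mul (differentiableAt_of_contDiffOn (hd.contDiffOn_rpow (-γ)) (by simp) hx) hv,
    hd.gradL_rpow _ hx, Real.rpow_sub_one hD.ne', smul_sub, smul_smul, smul_smul, sub_eq_add_neg,
    ← neg_smul]
  congr 2
  ring

lemma IsPotential.ae_ne_zero (hd : IsPotential σ d β) : ∀ᵐ x : E N, x ≠ 0 := by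
  -- In dimension zero the origin is not a null set, but there `∇_L d` is a sum over no indices and
  -- cannot be nonzero.
  rcases Nat.eq_zero_or_pos N with rfl | hN
  · filter_upwards [hd.gradL_ne_zero] with x hx
    exact absurd (by ext i; simp [gradL_apply]) hx
  · have : Nonempty (Fin N) := ⟨⟨0, hN⟩⟩
    exact compl_mem_ae_iff.2 (measure_singleton 0)

lemma eqOn_zero_of_ae_eq_zero {f : E N → ℝ} (hf : ContinuousOn f {0}ᶜ) (h0 : ∀ᵐ x, f x = 0)
    {x : E N} (hx : x ≠ 0) : f x = 0 :=
  Measure.eqOn_open_of_ae_eq (μ := volume) (g := fun _ => (0 : ℝ)) (ae_restrict_of_ae h0)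
    isOpen_punctured hf continuousOn_const hx

/-- For `p > 2` the factor `|v|^{p-2}` hides the gradient on the zero set of `v`. If the gradient
were nonzero at a point, it would be so nearby by continuity; then `v` would vanish near the point,
and the gradient with it. -/
lemma gradL_weighted_eq_zero (hd : IsPotential σ d β) (hp : 2 ≤ p) (hv : ContDiffOn ℝ 2 v {0}ᶜ)
    (h0 : ∀ᵐ x, remDensity σ d p s γ v x = 0) {x : E N} (hx : x ≠ 0) :
    gradL σ (fun y => d y ^ (-γ) * v y) x = 0 := by
  have hw : ContDiffOn ℝ 1 (fun y => d y ^ (-γ) * v y) {0}ᶜ :=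
    ((hd.contDiffOn_rpow _).of_le (by exact_mod_cast (le_top : (1 : ℕ∞) ≤ ⊤))).mul
      (hv.of_le one_le_two)
  have hcont := continuousOn_gradL hd.contDiffOn_coeff hw
  by_contra hne
  have hnear : ∀ᶠ y in 𝓝 x, gradL σ (fun y => d y ^ (-γ) * v y) y ≠ 0 :=
    (hcont.continuousAt (punctured_mem_nhds hx)).eventually_ne hne
  have hv0 : (fun y => d y ^ (-γ) * v y) =ᶠ[𝓝 x] fun _ => 0 := by
    filter_upwards [hnear, punctured_mem_nhds hx] with y hy hy0
    have hy0' : y ≠ 0 := hy0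
    have hrem := eqOn_zero_of_ae_eq_zero (continuousOn_remDensity hd hp hv) h0 hy0'
    rw [hd.gradL_weighted hy0' (differentiableAt_of_contDiffOn hv two_ne_zero hy0')] at hy
    have hD := hd.pos y hy0'
    by_contra hvy
    have hvy' : v y ≠ 0 := fun h => hvy (by rw [h, mul_zero])
    simp only [remDensity, mul_eq_zero] at hrem
    rcases hrem with (h1 | h1) | h1
    · exact (Real.rpow_pos_of_pos (abs_pos.2 hvy') _).ne' h1
    · exact (Real.rpow_pos_of_pos hD _).ne' h1
    · rw [norm_eq_zero.1 (pow_eq_zero_iff two_ne_zero |>.1 h1), smul_zero] at hy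
      exact hy rfl
  exact hne ((gradL_congr hv0).trans (gradL_zero x))

/-- A compactly supported function without derivatives along the fields vanishes. -/
lemma eq_zero_of_gradL_eq_zero (hd : IsPotential σ d β) {w : E N → ℝ}
    (hw : ContDiffOn ℝ 1 w {0}ᶜ) (hc : HasCompactSupport w) (hs : tsupport w ⊆ {0}ᶜ)
    (h0 : ∀ x, x ≠ 0 → gradL σ w x = 0) : w = 0 := by
  -- The power `d^β` contributes `β` and the equation for `d` contributes `1 - β`, so Green's
  -- formula leaves the integral of the nonnegative function `w² d^{β-1} |∇_L d|²`.
  set F : E N → ℝ := fun y => (w y * w y) * d y ^ β with hF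
  have z : ∀ x, x ∉ tsupport w → F x = 0 := fun x hx => by
    simp [hF, image_eq_zero_of_notMem_tsupport hx]
  have t := tsupport_subset_of_eq_zero z
  have k := hc.of_isClosed_subset (isClosed_tsupport F) t
  have c : ContDiffOn ℝ 1 F {0}ᶜ := (hw.mul hw).mul
    ((hd.contDiffOn_rpow _).of_le (by exact_mod_cast (le_top : (1 : ℕ∞) ≤ ⊤)))
  have hg := integral_green hd.contDiffOn_coeff c k (t.trans hs) hd.contDiffOn_two
  have hi := integrable_green hd.contDiffOn_coeff c k (t.trans hs) hd.contDiffOn_two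
  have heq : ∀ x, x ≠ 0 → F x * opL σ d x + inner ℝ (gradL σ F x) (gradL σ d x)
      = w x ^ 2 * (d x ^ β / d x) * ‖gradL σ d x‖ ^ 2 := fun x hx => by
    have hD := hd.pos x hx
    have hwx := differentiableAt_of_contDiffOn hw one_ne_zero hx
    have hdx := differentiableAt_of_contDiffOn (hd.contDiffOn_rpow β) (by simp) hx
    rw [hF, gradL_mul (f := fun y => w y * w y) (hwx.mul hwx) hdx, gradL_mul hwx hwx, h0 x hx, hd.gradL_rpow _ hx,
      hd.opL_eq x hx, Real.rpow_sub_one hD.ne']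
    simp only [smul_zero, add_zero, real_inner_smul_left, real_inner_self_eq_norm_sq]
    field_simp
    ring
  have hnn : 0 ≤ᵐ[volume] fun x => F x * opL σ d x + inner ℝ (gradL σ F x) (gradL σ d x) := by
    filter_upwards [hd.ae_ne_zero] with x hx
    have hD := hd.pos x hx
    simp only [heq x hx, Pi.zero_apply]
    positivity
  have hz := (integral_eq_zero_iff_of_nonneg_ae hnn hi).1 hg
  have hw0 : w =ᵐ[volume] (0 : E N → ℝ) := by
    filter_upwards [hz, hd.ae_ne_zero, hd.gradL_ne_zero] with x h1 hx hgx
    have hD := hd.pos x hx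
    rw [heq x hx] at h1
    have hpos : 0 < d x ^ β / d x := div_pos (Real.rpow_pos_of_pos hD _) hD
    simpa [hpos.ne', hgx] using h1
  exact (Continuous.ae_eq_iff_eq volume (continuous_of_continuousOn_punctured hw.continuousOn hs)
    continuous_const).1 hw0

lemma eq_zero_of_remDensity (hd : IsPotential σ d β) (hp : 2 ≤ p) (hu : IsTest u)
    (h0 : ∫ x, remDensity σ d p s γ u x = 0) : u = 0 := by
  have hnn : 0 ≤ᵐ[volume] remDensity σ d p s γ u := by
    filter_upwards [hd.ae_ne_zero] with x hx using remDensity_nonneg hd hx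
  have hz := (integral_eq_zero_iff_of_nonneg_ae hnn (integrable_remDensity hd hp hu)).1 h0
  set w : E N → ℝ := fun y => d y ^ (-γ) * u y with hw
  have z : ∀ x, x ∉ tsupport u → w x = 0 := fun x hx => by
    simp [hw, image_eq_zero_of_notMem_tsupport hx]
  have t := tsupport_subset_of_eq_zero z
  have hw1 : ContDiffOn ℝ 1 w {0}ᶜ :=
    ((hd.contDiffOn_rpow _).of_le (by exact_mod_cast (le_top : (1 : ℕ∞) ≤ ⊤))).mul
      hu.contDiffOn_one
  have hw0 := eq_zero_of_gradL_eq_zero hd hw1 (hu.compact.of_isClosed_subset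
    (isClosed_tsupport w) t) (t.trans hu.support)
    fun x hx => gradL_weighted_eq_zero hd hp hu.contDiffOn_two hz hx
  funext x
  by_cases hx : x ∈ tsupport u
  · have := congrFun hw0 x
    simp only [hw, Pi.zero_apply, mul_eq_zero] at this
    exact this.resolve_left (Real.rpow_pos_of_pos (hd.pos x (hu.support hx)) _).ne'
  · exact image_eq_zero_of_notMem_tsupport hx

lemma highDensity_nonneg (hd : IsPotential σ d β) {x : E N} (hx : x ≠ 0) :
    0 ≤ highDensity σ d p θ u x := by
  have := hd.pos x hx
  unfold highDensity
  positivity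

lemma lowDensity_nonneg (hd : IsPotential σ d β) {x : E N} (hx : x ≠ 0) :
    0 ≤ lowDensity σ d p θ u x := by
  have := hd.pos x hx
  unfold lowDensity
  positivity

lemma integral_lowDensity_pos (hd : IsPotential σ d β) (hp : 2 ≤ p) (hu : IsTest u)
    (hu0 : u ≠ 0) : 0 < ∫ x, lowDensity σ d p θ u x := by
  have hnn : 0 ≤ᵐ[volume] lowDensity σ d p θ u := by
    filter_upwards [hd.ae_ne_zero] with x hx using lowDensity_nonneg hd hx
  refine lt_of_le_of_ne (integral_nonneg_of_ae hnn) fun h => hu0 ?_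
  have hz := (integral_eq_zero_iff_of_nonneg_ae hnn (integrable_lowDensity hd hp hu)).1 h.symm
  refine (Continuous.ae_eq_iff_eq volume hu.smooth.continuous continuous_const).1 ?_
  filter_upwards [hz, hd.ae_ne_zero, hd.gradL_ne_zero] with x h1 hx hg
  have hD := Real.rpow_pos_of_pos (hd.pos x hx) (p * (θ + 2))
  have hG : 0 < ‖gradL σ d x‖ := norm_pos_iff.2 hg
  have h2 : |u x| ^ p = 0 := by simpa [lowDensity, hD.ne', hg] using h1
  exact abs_eq_zero.1 ((Real.rpow_eq_zero (abs_nonneg _) (by linarith)).1 h2)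

lemma integral_remDensity_nonneg (hd : IsPotential σ d β) :
    0 ≤ ∫ x, remDensity σ d p s γ u x := by
  refine integral_nonneg_of_ae ?_
  filter_upwards [hd.ae_ne_zero] with x hx using remDensity_nonneg hd hx

/-- This serves the case `C = 0`, where `deficit_ge` gives no control of the remainder: equality
then means that `L u` vanishes almost everywhere. -/
lemma crossDensity_ae_eq_zero (hd : IsPotential σ d β) (hp : 2 ≤ p)
    (hi : Integrable (highDensity σ d p θ u)) (h0 : ∫ x, highDensity σ d p θ u x ≤ 0) :
    crossDensity σ d p s u =ᵐ[volume] 0 := by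
  have hnn : 0 ≤ᵐ[volume] highDensity σ d p θ u := by
    filter_upwards [hd.ae_ne_zero] with x hx using highDensity_nonneg hd hx
  have hz := (integral_eq_zero_iff_of_nonneg_ae hnn hi).1
    (le_antisymm h0 (integral_nonneg_of_ae hnn))
  filter_upwards [hz, hd.ae_ne_zero, hd.gradL_ne_zero] with x h1 hx hgx
  have hD := hd.pos x hx
  have hG : 0 < ‖gradL σ d x‖ := norm_pos_iff.2 hgx
  have hden : 0 < d x ^ (p * θ) * ‖gradL σ d x‖ ^ (2 * (p - 1)) := by positivity
  have h2 : |opL σ u x| ^ p = 0 := by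
    simpa [highDensity, hden.ne'] using (div_eq_zero_iff.1 h1).resolve_right hden.ne'
  have h3 : opL σ u x = 0 := abs_eq_zero.1 ((Real.rpow_eq_zero (abs_nonneg _) (by linarith)).1 h2)
  simp [crossDensity, h3]

/-- Equality forces `∫ R = 0`: through the deficit bound if `C > 0`, through `L u = 0` and the
remainder identity if `C = 0`. A test function with zero remainder is zero. -/
theorem strict_inequality (hd : IsPotential σ d β) (hp : 2 ≤ p) (hC : 0 ≤ const β p θ)
    (hu : IsTest u) (hi : Integrable (highDensity σ d p θ u)) (hu0 : u ≠ 0) :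
    const β p θ ^ p * ∫ x, lowDensity σ d p θ u x < ∫ x, highDensity σ d p θ u x := by
  have hs : p * θ + 2 * p - 2 = p * θ + 2 * p - 2 := rfl
  have hγ : p * ((β + (p * θ + 2 * p - 2)) / p) = β + (p * θ + 2 * p - 2) := by
    field_simp [show p ≠ 0 by linarith]
  by_contra! hle
  refine hu0 (eq_zero_of_remDensity hd hp hu (le_antisymm ?_
    (integral_remDensity_nonneg hd)) (γ := (β + (p * θ + 2 * p - 2)) / p)
    (s := p * θ + 2 * p - 2))
  rcases hC.lt_or_eq with hC | hC
  · have hdef := deficit_ge hd hp hs hγ hC.le hu hi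
    have h1 : 0 < p * const β p θ ^ (p - 1) * (p - 1) :=
      mul_pos (mul_pos (by linarith) (Real.rpow_pos_of_pos hC _)) (by linarith)
    by_contra! hpos
    have := mul_pos h1 hpos
    linarith
  · rw [← hC, Real.zero_rpow (by linarith), zero_mul] at hle
    have hcross := integral_congr_ae (crossDensity_ae_eq_zero (s := p * θ + 2 * p - 2) hd hp hi hle)
    have hid := integral_remDensity hd hp hs hγ hu
    rw [← const_eq hp hs hγ, ← hC, hcross] at hid
    simp only [Pi.zero_apply, integral_zero, zero_mul, add_zero] at hid
    exact ((mul_eq_zero.1 hid).resolve_left (by linarith)).le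

lemma TendstoC2Loc.tendsto_apply {f : ℕ → E N → ℝ} (hf : TendstoC2Loc f v) {x : E N}
    (hx : x ≠ 0) : Tendsto (fun n => f n x) atTop (𝓝 (v x)) := by
  have h1 := (hf {x} isCompact_singleton (by simpa using hx.symm) 0 (by norm_num)).tendsto_at
    (Set.mem_singleton x)
  have h2 := ((ContinuousMultilinearMap.apply ℝ (fun _ : Fin 0 => E N) ℝ 0).continuous.tendsto
    _).comp h1
  simpa [Function.comp_def] using h2

lemma TendstoC2Loc.tendsto_pderiv {f : ℕ → E N → ℝ} (hf : TendstoC2Loc f v) {x : E N}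
    (hx : x ≠ 0) (j : Fin N) : Tendsto (fun n => pderiv j (f n) x) atTop (𝓝 (pderiv j v x)) := by
  have h1 := (hf {x} isCompact_singleton (by simpa using hx.symm) 1 (by norm_num)).tendsto_at
    (Set.mem_singleton x)
  have h2 := ((ContinuousMultilinearMap.apply ℝ (fun _ : Fin 1 => E N) ℝ
    fun _ => EuclideanSpace.single j 1).continuous.tendsto _).comp h1
  simpa [Function.comp_def, iteratedFDeriv_one_apply, pderiv] using h2

lemma TendstoC2Loc.tendsto_gradL {f : ℕ → E N → ℝ} (hf : TendstoC2Loc f v) {x : E N}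
    (hx : x ≠ 0) : Tendsto (fun n => gradL σ (f n) x) atTop (𝓝 (gradL σ v x)) := by
  refine ((PiLp.continuous_toLp 2 (fun _ : Fin h => ℝ)).tendsto _).comp (tendsto_pi_nhds.2 fun i => ?_)
  exact tendsto_finsetSum _ fun j _ => (hf.tendsto_pderiv hx j).const_mul _

lemma TendstoC2Loc.tendsto_remDensity (hp : 2 ≤ p) {f : ℕ → E N → ℝ} (hf : TendstoC2Loc f v)
    {x : E N} (hx : x ≠ 0) :
    Tendsto (fun n => remDensity σ d p s γ (f n) x) atTop (𝓝 (remDensity σ d p s γ v x)) := by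
  have h1 := hf.tendsto_apply hx
  have h2 := ((continuous_abs_rpow (show 0 ≤ p - 2 by linarith)).tendsto (v x)).comp h1
  have h3 := (hf.tendsto_gradL (σ := σ) hx).sub
    (((h1.const_mul γ).div_const (d x)).smul_const (gradL σ d x))
  exact (h2.mul_const _).mul (h3.norm.pow 2)

/-- The deficit bound makes `∫ R` tend to zero along the approximating sequence. The remainders
converge pointwise because first derivatives do, and Fatou's lemma gives a zero remainder for the
limit without any integrability of `v`. -/
theorem gradL_weighted_eq_zero_of_isMaximizing (hd : IsPotential σ d β) (hp : 2 ≤ p)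
    (hs : s = p * θ + 2 * p - 2) (hγ : p * γ = β + s) (hC : 0 < const β p θ)
    (hi : ∀ u, IsTest u → Integrable (highDensity σ d p θ u))
    (hv : IsMaximizing σ d β p θ v) {x : E N} (hx : x ≠ 0) :
    gradL σ (fun y => d y ^ (-γ) * v y) x = 0 := by
  obtain ⟨hv2, f, hf, hfv, hlim⟩ := hv
  refine gradL_weighted_eq_zero (s := s) hd hp hv2 ?_ hx
  set K := p * const β p θ ^ (p - 1) * (p - 1) with hK
  have hK0 : 0 < K := mul_pos (mul_pos (by linarith) (Real.rpow_pos_of_pos hC _)) (by linarith)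
  have hR : Tendsto (fun n => ∫ x, remDensity σ d p s γ (f n) x) atTop (𝓝 0) := by
    refine squeeze_zero (fun n => integral_remDensity_nonneg hd) (fun n => ?_)
      (by simpa using hlim.div_const K)
    have := deficit_ge hd hp hs hγ hC.le (hf n) (hi _ (hf n))
    rw [le_div_iff₀ hK0]
    calc _ = p * const β p θ ^ (p - 1) * ((p - 1) * ∫ x, remDensity σ d p s γ (f n) x) := by
          rw [hK]; ring
      _ ≤ _ := this
  have hmeas : ∀ n, AEMeasurable (fun x => ENNReal.ofReal (remDensity σ d p s γ (f n) x)) :=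
    fun n => (integrable_remDensity hd hp (hf n)).aestronglyMeasurable.aemeasurable.ennreal_ofReal
  have hpt : ∀ᵐ x : E N, Tendsto (fun n => ENNReal.ofReal (remDensity σ d p s γ (f n) x)) atTop
      (𝓝 (ENNReal.ofReal (remDensity σ d p s γ v x))) := by
    filter_upwards [hd.ae_ne_zero] with x hx
    exact (ENNReal.continuous_ofReal.tendsto _).comp (hfv.tendsto_remDensity hp hx)
  have hfatou : ∫⁻ x, ENNReal.ofReal (remDensity σ d p s γ v x) = 0 := by
    refine le_antisymm ?_ zero_le
    calc ∫⁻ x, ENNReal.ofReal (remDensity σ d p s γ v x)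
        = ∫⁻ x, liminf (fun n => ENNReal.ofReal (remDensity σ d p s γ (f n) x)) atTop := by
          refine lintegral_congr_ae ?_
          filter_upwards [hpt] with x hx using hx.liminf_eq.symm
      _ ≤ liminf (fun n => ∫⁻ x, ENNReal.ofReal (remDensity σ d p s γ (f n) x)) atTop :=
          lintegral_liminf_le' hmeas
      _ = 0 := by
          have h1 : Tendsto (fun n => ∫⁻ x, ENNReal.ofReal (remDensity σ d p s γ (f n) x)) atTop
              (𝓝 0) := by
            have h2 := (ENNReal.continuous_ofReal.tendsto 0).comp hR
            rw [ENNReal.ofReal_zero] at h2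
            refine h2.congr fun n => ?_
            refine ofReal_integral_eq_lintegral_ofReal (integrable_remDensity hd hp (hf n)) ?_
            filter_upwards [hd.ae_ne_zero] with x hx using remDensity_nonneg hd hx
          exact h1.liminf_eq
  have hae := (lintegral_eq_zero_iff' (aemeasurable_of_tendsto_metrizable_ae _ hmeas hpt)).1 hfatou
  filter_upwards [hae, hd.ae_ne_zero] with x h1 hx
  exact le_antisymm (ENNReal.ofReal_eq_zero.1 h1) (remDensity_nonneg hd hx)

end Rigidity

end Rellich

namespace Rellich

/-! ### Compactly supported primitives on the line -/

section Primitive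

lemma exists_primitive_of_integral_eq_zero {g : ℝ → ℝ} (hg : Continuous g)
    (hc : HasCompactSupport g) (h0 : ∫ t, g t = 0) :
    ∃ G : ℝ → ℝ, (∀ t, HasDerivAt G (g t) t) ∧ HasCompactSupport G := by
  obtain ⟨M, hM⟩ := hc.isBounded.subset_ball 0
  have hz : ∀ t, M ≤ |t| → g t = 0 := fun t ht => by
    refine image_eq_zero_of_notMem_tsupport fun h => ?_
    have := hM h
    rw [mem_ball_zero_iff, Real.norm_eq_abs] at this
    linarith
  refine ⟨fun t => ∫ r in (-M)..t, g r, fun t => (hg.integral_hasStrictDerivAt _ t).hasDerivAt,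
    HasCompactSupport.intro (isCompact_Icc (a := -M) (b := M)) fun t ht => ?_⟩
  rw [Set.mem_Icc, not_and_or, not_le, not_le] at ht
  rcases ht with ht | ht
  · refine intervalIntegral.integral_zero_ae (Eventually.of_forall fun r hr => hz r ?_)
    rw [Set.uIoc_of_ge ht.le] at hr
    exact (le_neg.2 hr.2).trans (neg_le_abs r)
  · rw [intervalIntegral.integral_eq_integral_of_support_subset, h0]
    intro r hr
    have h1 : |r| < M := lt_of_not_ge fun h => hr (hz r h)
    exact ⟨(abs_lt.1 h1).1, ((abs_lt.1 h1).2.trans ht).le⟩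

end Primitive

/-- The function `f (log d)` on the punctured space, extended by zero. -/
noncomputable def radial {N : ℕ} (d : E N → ℝ) (f : ℝ → ℝ) (x : E N) : ℝ :=
  open Classical in if x = 0 then 0 else f (Real.log (d x))

/-! ### Functions of `log d` and reduction to one dimension -/

section Radial

variable {N h : ℕ} {σ : Fin h → Fin N → E N → ℝ} {d : E N → ℝ} {β p θ s γ : ℝ} {f : ℝ → ℝ}

lemma radial_apply {x : E N} (hx : x ≠ 0) : radial d f x = f (Real.log (d x)) := by
  simp [radial, hx]

lemma radial_eventuallyEq {x : E N} (hx : x ≠ 0) :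
    radial d f =ᶠ[𝓝 x] fun y => f (Real.log (d y)) := by
  filter_upwards [punctured_mem_nhds hx] with y hy using radial_apply hy

/-- A bound on `log d` confines `d` to a shell `[e^{-M}, e^M]`; here the compactness of the shells
enters. -/
lemma exists_tsupport_radial_subset (hd : IsPotential σ d β)
    (hshell : ∀ a b : ℝ, 0 < a → a ≤ b → IsCompact {x : E N | x ≠ 0 ∧ a ≤ d x ∧ d x ≤ b})
    (hf : HasCompactSupport f) :
    ∃ K : Set (E N), IsCompact K ∧ K ⊆ {0}ᶜ ∧ tsupport (radial d f) ⊆ K := by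
  obtain ⟨M, hM⟩ := hf.isBounded.subset_ball 0
  have hK := hshell (Real.exp (-|M|)) (Real.exp |M|) (Real.exp_pos _)
    (Real.exp_le_exp.2 (by linarith [abs_nonneg M]))
  refine ⟨_, hK, fun x hx => hx.1, closure_minimal (fun x hx => ?_) hK.isClosed⟩
  have hx0 : x ≠ 0 := fun h => hx (by simp [radial, h])
  have hD := hd.pos x hx0
  have h1 : Real.log (d x) ∈ tsupport f := subset_tsupport f (by
    rw [Function.mem_support, ← radial_apply (d := d) (f := f) hx0]; exact hx)
  have h2 := hM h1
  rw [mem_ball_zero_iff, Real.norm_eq_abs] at h2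
  have h3 := abs_le.1 (h2.le.trans (le_abs_self M))
  exact ⟨hx0, (Real.le_log_iff_exp_le hD).1 h3.1, (Real.log_le_iff_le_exp hD).1 h3.2⟩

lemma contDiffOn_radial (hd : IsPotential σ d β) {n : WithTop ℕ∞} (hn : n ≤ ∞)
    (hf : ContDiff ℝ n f) : ContDiffOn ℝ n (radial d f) {0}ᶜ := by
  have h1 : ContDiffOn ℝ n (fun y => f (Real.log (d y))) {0}ᶜ :=
    hf.comp_contDiffOn ((hd.contDiffOn.of_le hn).log fun x hx => (hd.pos x hx).ne')
  exact h1.congr fun x hx => radial_apply hx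

lemma continuousOn_radial (hd : IsPotential σ d β) (hf : Continuous f) :
    ContinuousOn (radial d f) {0}ᶜ :=
  (contDiffOn_radial hd (n := 0) (by simp) (contDiff_zero.2 hf)).continuousOn

lemma gradL_radial (hd : IsPotential σ d β) {x : E N} (hx : x ≠ 0) {f' : ℝ}
    (hf : HasDerivAt f f' (Real.log (d x))) :
    gradL σ (radial d f) x = (f' / d x) • gradL σ d x := by
  rw [gradL_congr (radial_eventuallyEq hx),
    gradL_comp (φ := fun r => f (Real.log r)) (φ' := f' / d x) ?_ (hd.differentiableAt hx)]
  exact hf.comp (d x) (Real.hasDerivAt_log (hd.pos x hx).ne')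

/-- The second derivative of the logarithm contributes `-f'` and the equation for `d` contributes
`(1-β) f'`, so an operator with constant coefficients remains. -/
lemma opL_radial (hd : IsPotential σ d β) {x : E N} (hx : x ≠ 0) {f' f'' : ℝ → ℝ}
    (hf : ∀ t, HasDerivAt f (f' t) t) (hf' : ∀ t, HasDerivAt f' (f'' t) t) :
    opL σ (radial d f) x
      = (f'' (Real.log (d x)) - β * f' (Real.log (d x))) * ‖gradL σ d x‖ ^ 2 / d x ^ 2 := by
  have hD := hd.pos x hx
  rw [opL_congr (radial_eventuallyEq hx), opL_comp hd.contDiffOn_coeff hd.contDiffOn_two hx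
    (φ := fun r => f (Real.log r)) (φ' := fun r => f' (Real.log r) * r⁻¹)
    (fun y hy => (hf _).comp (d y) (Real.hasDerivAt_log (hd.pos y hy).ne'))
    (((hf' _).comp (d x) (Real.hasDerivAt_log hD.ne')).mul (hasDerivAt_inv hD.ne')),
    hd.opL_eq x hx]
  simp only [Function.comp_def]
  field_simp
  ring

/-- The weight `d^{β-2} |∇_L d|^2`, whose image under `log d` is a multiple of the Lebesgue
measure. -/
noncomputable def radialWeight (σ : Fin h → Fin N → E N → ℝ) (d : E N → ℝ) (β : ℝ)
    (x : E N) : ℝ :=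
  d x ^ (β - 2) * ‖gradL σ d x‖ ^ 2

lemma integrable_radial_mul_weight (hd : IsPotential σ d β)
    (hshell : ∀ a b : ℝ, 0 < a → a ≤ b → IsCompact {x : E N | x ≠ 0 ∧ a ≤ d x ∧ d x ≤ b})
    (hf : Continuous f) (hc : HasCompactSupport f) :
    Integrable fun x => radial d f x * radialWeight σ d β x := by
  obtain ⟨K, hK, hK0, hsub⟩ := exists_tsupport_radial_subset hd hshell hc
  refine integrable_of_eq_zero_off_tsupport (hK.of_isClosed_subset (isClosed_tsupport _) hsub)
    (hsub.trans hK0) ((continuousOn_radial hd hf).mul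
      ((hd.contDiffOn_rpow _).continuousOn.mul (hd.continuousOn_gradL.norm.pow 2))) fun x hx => ?_
  rw [image_eq_zero_of_notMem_tsupport hx, zero_mul]

/-- Green's formula for `d` and the test function `f(log d) d^{β-1}`: the power of `d` is chosen so
that the terms in `f` cancel and only `f'` survives. -/
lemma integral_radial_deriv (hd : IsPotential σ d β)
    (hshell : ∀ a b : ℝ, 0 < a → a ≤ b → IsCompact {x : E N | x ≠ 0 ∧ a ≤ d x ∧ d x ≤ b})
    {g : ℝ → ℝ} (hg : Continuous g) (hf : ∀ t, HasDerivAt f (g t) t)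
    (hc : HasCompactSupport f) : ∫ x, radial d g x * radialWeight σ d β x = 0 := by
  have hexp : ∀ t, HasDerivAt (fun t => Real.exp ((β - 1) * t))
      (Real.exp ((β - 1) * t) * (β - 1)) t := fun t => by
    simpa using ((hasDerivAt_id t).const_mul (β - 1)).exp
  set F : ℝ → ℝ := fun t => f t * Real.exp ((β - 1) * t) with hF
  have hF' : ∀ t, HasDerivAt F ((g t + (β - 1) * f t) * Real.exp ((β - 1) * t)) t := fun t =>
    ((hf t).mul (hexp t)).congr_deriv (by ring)
  have hFc : HasCompactSupport F := hc.mul_right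
  have hfcont : Continuous f := continuous_iff_continuousAt.2 fun t => (hf t).continuousAt
  have hF1 : ContDiff ℝ 1 F := by
    rw [contDiff_one_iff_deriv]
    refine ⟨fun t => (hF' t).differentiableAt, ?_⟩
    rw [show deriv F = _ from funext fun t => (hF' t).deriv]
    fun_prop
  obtain ⟨K, hK, hK0, hsub⟩ := exists_tsupport_radial_subset hd hshell hFc
  have hgreen := integral_green hd.contDiffOn_coeff
    (contDiffOn_radial hd (by exact_mod_cast (le_top : (1 : ℕ∞) ≤ ⊤)) hF1)
    (hK.of_isClosed_subset (isClosed_tsupport _) hsub) (hsub.trans hK0) hd.contDiffOn_two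
  rw [← hgreen]
  refine integral_congr_ae ?_
  filter_upwards [hd.ae_ne_zero] with x hx
  have hD := hd.pos x hx
  have he : Real.exp ((β - 1) * Real.log (d x)) = d x ^ (β - 2) * d x := by
    rw [← Real.rpow_add_one hD.ne', Real.rpow_def_of_pos hD]
    ring_nf
  rw [gradL_radial hd hx (hF' _), hd.opL_eq x hx, radial_apply hx, radial_apply hx, radialWeight,
    real_inner_smul_left, real_inner_self_eq_norm_sq, hF]
  simp only [he]
  field_simp
  ring

/-- The integral against the weight is a linear functional of `f` that vanishes on derivatives of
compactly supported functions, hence on every `f` of integral zero. It is therefore a multiple of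
the integral of `f`. This plays the role of a coarea formula. -/
theorem exists_integral_radial (hd : IsPotential σ d β)
    (hshell : ∀ a b : ℝ, 0 < a → a ≤ b → IsCompact {x : E N | x ≠ 0 ∧ a ≤ d x ∧ d x ≤ b}) :
    ∃ c : ℝ, 0 < c ∧ ∀ f : ℝ → ℝ, Continuous f → HasCompactSupport f →
      ∫ x, radial d f x * radialWeight σ d β x = c * ∫ t, f t := by
  obtain ⟨x₀, hx₀⟩ := hd.ae_ne_zero.exists
  -- The bump is centred at a value taken by `log d`, so that the factor `c`, the value of the
  -- functional on the normalized bump, is positive.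
  let b : ContDiffBump (Real.log (d x₀)) := ⟨1, 2, one_pos, one_lt_two⟩
  set χ : ℝ → ℝ := b.normed volume with hχ
  have hχc : Continuous χ := b.continuous_normed
  have hχs : HasCompactSupport χ := b.hasCompactSupport_normed
  have hχ1 : ∫ t, χ t = 1 := b.integral_normed
  refine ⟨∫ x, radial d χ x * radialWeight σ d β x, ?_, fun f hf hc => ?_⟩
  · have hi := integrable_radial_mul_weight hd hshell hχc hχs
    have hnn : 0 ≤ᵐ[volume] fun x => radial d χ x * radialWeight σ d β x := by
      filter_upwards [hd.ae_ne_zero] with x hx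
      have hD := hd.pos x hx
      simp only [radial_apply hx, radialWeight]
      have := b.nonneg_normed (μ := volume) (Real.log (d x))
      exact mul_nonneg this (by positivity)
    refine lt_of_le_of_ne (integral_nonneg_of_ae hnn) fun h => ?_
    have hz := (integral_eq_zero_iff_of_nonneg_ae hnn hi).1 h.symm
    have hz' : ∀ᵐ x, radial d χ x = 0 := by
      filter_upwards [hz, hd.ae_ne_zero, hd.gradL_ne_zero] with x h1 hx hgx
      have hD := hd.pos x hx
      have hG : 0 < ‖gradL σ d x‖ := norm_pos_iff.2 hgx
      have hw : radialWeight σ d β x ≠ 0 := by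
        unfold radialWeight
        positivity
      exact (mul_eq_zero.1 h1).resolve_right hw
    have h0 := eqOn_zero_of_ae_eq_zero (continuousOn_radial hd hχc) hz' hx₀
    rw [radial_apply hx₀] at h0
    have hmem : Real.log (d x₀) ∈ Function.support χ := by
      rw [hχ, b.support_normed_eq]
      exact Metric.mem_ball_self b.rOut_pos
    exact hmem h0
  · have hi := integrable_radial_mul_weight (σ := σ) hd hshell hf hc
    have hiχ := integrable_radial_mul_weight (σ := σ) hd hshell hχc hχs
    set g : ℝ → ℝ := fun t => f t - (∫ t, f t) * χ t with hg
    have hgc : Continuous g := hf.sub (continuous_const.mul hχc)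
    have hgs : HasCompactSupport g := hc.sub hχs.mul_left
    have hg0 : ∫ t, g t = 0 := by
      rw [hg, integral_sub (hf.integrable_of_hasCompactSupport hc)
        ((hχc.integrable_of_hasCompactSupport hχs).const_mul _), integral_const_mul, hχ1]
      ring
    obtain ⟨G, hG, hGs⟩ := exists_primitive_of_integral_eq_zero hgc hgs hg0
    have h0 := integral_radial_deriv (σ := σ) hd hshell hgc hG hGs
    have heq : (fun x => radial d g x * radialWeight σ d β x) = fun x =>
        radial d f x * radialWeight σ d β x
          - (∫ t, f t) * (radial d χ x * radialWeight σ d β x) := by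
      funext x
      by_cases hx : x = 0
      · simp [radial, hx]
      · rw [radial_apply hx, radial_apply hx, radial_apply hx]
        ring
    rw [heq, integral_sub hi (hiχ.const_mul _), integral_const_mul] at h0
    linarith

end Radial

/-! ### Dilated cutoffs of `d^γ` and sharpness -/

section Sharpness

variable {N h : ℕ} {σ : Fin h → Fin N → E N → ℝ} {d : E N → ℝ} {β p θ s γ : ℝ} {φ : ℝ → ℝ}

lemma isTest_radial (hd : IsPotential σ d β)
    (hshell : ∀ a b : ℝ, 0 < a → a ≤ b → IsCompact {x : E N | x ≠ 0 ∧ a ≤ d x ∧ d x ≤ b})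
    (hφ : ContDiff ℝ ∞ φ) (hc : HasCompactSupport φ) : IsTest (radial d φ) := by
  obtain ⟨K, hK, hK0, hsub⟩ := exists_tsupport_radial_subset hd hshell hc
  exact ⟨contDiff_of_contDiffOn_punctured (contDiffOn_radial hd le_rfl hφ) (hsub.trans hK0),
    hK.of_isClosed_subset (isClosed_tsupport _) hsub, hsub.trans hK0⟩

lemma exp_mul_log_eq_rpow {r : ℝ} (hr : 0 < r) (a : ℝ) : Real.exp (a * Real.log r) = r ^ a := by
  rw [Real.rpow_def_of_pos hr, mul_comm]

/-- The exponent `γ` is the one with `pγ - p(θ+2) = β - 2`, which leaves exactly the weight whose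
image under `log d` is known. -/
lemma lowDensity_radial (hd : IsPotential σ d β) (hs : s = p * θ + 2 * p - 2)
    (hγ : p * γ = β + s) {x : E N} (hx : x ≠ 0) :
    lowDensity σ d p θ (radial d fun t => Real.exp (γ * t) * φ t) x
      = radial d (fun t => |φ t| ^ p) x * radialWeight σ d β x := by
  have hD := hd.pos x hx
  rw [lowDensity, radial_apply hx, radial_apply hx, radialWeight, exp_mul_log_eq_rpow hD, abs_mul,
    abs_of_pos (Real.rpow_pos_of_pos hD _), Real.mul_rpow (by positivity) (abs_nonneg _),
    ← Real.rpow_mul hD.le, div_eq_mul_inv, ← Real.rpow_neg hD.le,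
    show β - 2 = γ * p + -(p * (θ + 2)) by rw [mul_comm γ p, hγ, hs]; ring, Real.rpow_add hD]
  ring

/-- Conjugating `f'' - β f'` by `e^{γt}` gives `φ'' + (2γ-β) φ' - γ(β-γ) φ`, whose zeroth-order
coefficient is `-C`. -/
lemma highDensity_radial (hd : IsPotential σ d β) (hs : s = p * θ + 2 * p - 2)
    (hγ : p * γ = β + s) {φ' φ'' : ℝ → ℝ} (hφ : ∀ t, HasDerivAt φ (φ' t) t)
    (hφ' : ∀ t, HasDerivAt φ' (φ'' t) t) {x : E N} (hx : x ≠ 0) (hg : gradL σ d x ≠ 0) :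
    highDensity σ d p θ (radial d fun t => Real.exp (γ * t) * φ t) x
      = radial d (fun t => |φ'' t + (2 * γ - β) * φ' t - γ * (β - γ) * φ t| ^ p) x
        * radialWeight σ d β x := by
  have hD := hd.pos x hx
  have hG : 0 < ‖gradL σ d x‖ := norm_pos_iff.2 hg
  have hexp : ∀ t, HasDerivAt (fun t => Real.exp (γ * t)) (Real.exp (γ * t) * γ) t := fun t => by
    simpa using ((hasDerivAt_id t).const_mul γ).exp
  have h1 : ∀ t, HasDerivAt (fun t => Real.exp (γ * t) * φ t)
      (Real.exp (γ * t) * (γ * φ t + φ' t)) t := fun t =>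
    ((hexp t).mul (hφ t)).congr_deriv (by ring)
  have h2 : ∀ t, HasDerivAt (fun t => Real.exp (γ * t) * (γ * φ t + φ' t))
      (Real.exp (γ * t) * (γ * (γ * φ t + φ' t) + (γ * φ' t + φ'' t))) t := fun t =>
    ((hexp t).mul (((hφ t).const_mul γ).add (hφ' t))).congr_deriv (by simp only [Pi.add_apply]; ring)
  rw [highDensity, opL_radial hd hx h1 h2, radial_apply hx, radialWeight]
  set T := Real.log (d x) with hT
  set A := φ'' T + (2 * γ - β) * φ' T - γ * (β - γ) * φ T with hA
  have e : (Real.exp (γ * T) * (γ * (γ * φ T + φ' T) + (γ * φ' T + φ'' T))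
      - β * (Real.exp (γ * T) * (γ * φ T + φ' T))) * ‖gradL σ d x‖ ^ 2 / d x ^ 2
      = A * (d x ^ (γ - 2) * ‖gradL σ d x‖ ^ (2 : ℝ)) := by
    have h3 : d x ^ (γ - 2) = d x ^ γ / d x ^ 2 := by
      rw [Real.rpow_sub hD]; norm_cast
    rw [hT, exp_mul_log_eq_rpow hD, ← hT, h3, hA]
    norm_cast
    ring
  rw [e, abs_mul, abs_of_pos (show 0 < d x ^ (γ - 2) * ‖gradL σ d x‖ ^ (2 : ℝ) by positivity),
    Real.mul_rpow (abs_nonneg _) (by positivity), Real.mul_rpow (by positivity) (by positivity),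
    ← Real.rpow_mul hD.le, ← Real.rpow_mul hG.le, div_eq_mul_inv, mul_inv, ← Real.rpow_neg hD.le,
    ← Real.rpow_neg hG.le]
  calc _ = |A| ^ p * ((d x ^ ((γ - 2) * p) * d x ^ (-(p * θ)))
        * (‖gradL σ d x‖ ^ (2 * p) * ‖gradL σ d x‖ ^ (-(2 * (p - 1))))) := by ring
    _ = |A| ^ p * (d x ^ (β - 2) * ‖gradL σ d x‖ ^ (2 : ℝ)) := by
        rw [← Real.rpow_add hD, ← Real.rpow_add hG]
        congr 3
        · rw [sub_mul, mul_comm γ p, hγ, hs]; ring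
        · ring
    _ = _ := by norm_cast

lemma hasCompactSupport_abs_rpow (hp : 2 ≤ p) {f : ℝ → ℝ}
    (hf : ∀ t, t ∉ tsupport φ → f t = 0) (hc : HasCompactSupport φ) :
    HasCompactSupport fun t => |f t| ^ p :=
  HasCompactSupport.intro hc fun t ht => by
    rw [hf t ht, abs_zero, Real.zero_rpow (by linarith)]

/-- The test function on the line: a cutoff equal to one near the origin. -/
lemma exists_cutoff : ∃ η : ℝ → ℝ, ContDiff ℝ ∞ η ∧ HasCompactSupport η ∧
    ∀ t, |t| < 1 → η t = 1 := by
  let b : ContDiffBump (0 : ℝ) := ⟨1, 2, one_pos, one_lt_two⟩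
  refine ⟨b, b.contDiff, b.hasCompactSupport, fun t ht => b.one_of_mem_closedBall ?_⟩
  rw [mem_closedBall_zero_iff, Real.norm_eq_abs]
  exact ht.le

/-- The first order expansion of the one-dimensional deficit along dilations vanishes. -/
lemma exists_tendsto_deficit_bound (hp : 2 ≤ p) (b C : ℝ) {η η' η'' : ℝ → ℝ}
    (hη : ∀ t, HasDerivAt η (η' t) t) (hη' : ∀ t, HasDerivAt η' (η'' t) t)
    (hη'' : Continuous η'') (hc : HasCompactSupport η) :
    ∃ J : ℝ → ℝ, Tendsto J (𝓝 0) (𝓝 0) ∧ ∀ ε > 0,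
      ε⁻¹ * ((∫ t, |ε ^ 2 * η'' t + b * (ε * η' t) - C * η t| ^ p) - ∫ t, |C * η t| ^ p) ≤ J ε := by
  have cη : Continuous η := continuous_iff_continuousAt.2 fun t => (hη t).continuousAt
  have cη' : Continuous η' := continuous_iff_continuousAt.2 fun t => (hη' t).continuousAt
  have zη : ∀ t, t ∉ tsupport η → η t = 0 := fun t ht => image_eq_zero_of_notMem_tsupport ht
  have eη' : η' = deriv η := funext fun t => (hη t).deriv.symm
  have eη'' : η'' = deriv η' := funext fun t => (hη' t).deriv.symm
  have sη' : tsupport η' ⊆ tsupport η := by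
    rw [eη']; exact closure_minimal support_deriv_subset (isClosed_tsupport _)
  have sη'' : tsupport η'' ⊆ tsupport η := by
    rw [eη'']
    exact closure_minimal (support_deriv_subset.trans sη') (isClosed_tsupport _)
  have zη' : ∀ t, t ∉ tsupport η → η' t = 0 := fun t ht =>
    image_eq_zero_of_notMem_tsupport fun h => ht (sη' h)
  have zη'' : ∀ t, t ∉ tsupport η → η'' t = 0 := fun t ht =>
    image_eq_zero_of_notMem_tsupport fun h => ht (sη'' h)
  have cψ : Continuous fun t : ℝ => |t| ^ (p - 2) * t := (contDiff_abs_rpow_mul_self hp).continuous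
  let y : ℝ → ℝ → ℝ := fun ε t => ε ^ 2 * η'' t + b * (ε * η' t) - C * η t
  -- The tangent inequality at `y` compared with `-C η`, divided by `ε`, bounds the difference
  -- quotient by `H`. The bound is continuous in `ε` up to `ε = 0`.
  let H : ℝ → ℝ → ℝ := fun ε t => p * (|y ε t| ^ (p - 2) * y ε t) * (ε * η'' t + b * η' t)
  have cy : Continuous (Function.uncurry y) := by
    simp only [y, Function.uncurry_def]
    fun_prop
  have cH : Continuous (Function.uncurry H) := by
    have h1 : Continuous fun q : ℝ × ℝ => |y q.1 q.2| ^ (p - 2) * y q.1 q.2 := cψ.comp cy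
    simp only [H, Function.uncurry_def]
    fun_prop
  have hJ : Continuous fun ε => ∫ t in tsupport η, H ε t :=
    continuous_parametric_integral_of_continuous cH hc
  have hset : ∀ ε, ∫ t in tsupport η, H ε t = ∫ t, H ε t := fun ε =>
    setIntegral_eq_integral_of_forall_compl_eq_zero fun t ht => by
      simp [H, zη' t ht, zη'' t ht]
  have hcs : ∀ g : ℝ → ℝ, Continuous g → (∀ t, t ∉ tsupport η → g t = 0) → Integrable g :=
    fun g hg h0 => hg.integrable_of_hasCompactSupport (HasCompactSupport.intro hc h0)
  refine ⟨fun ε => ∫ t, H ε t, ?_, fun ε hε => ?_⟩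
  -- At `ε = 0` the integrand is a constant multiple of the derivative of `|η|^p`.
  · have h0 : ∫ t, H 0 t = 0 := by
      have h1 : ∀ t, HasDerivAt (fun t => |η t| ^ p) (p * |η t| ^ (p - 2) * η t * η' t) t :=
        fun t => (hasDerivAt_abs_rpow (η t) (by linarith)).comp t (hη t)
      have h2 : ∫ t, p * |η t| ^ (p - 2) * η t * η' t = 0 := by
        have c0 : Continuous fun t => |η t| ^ p := (continuous_abs_rpow (by linarith)).comp cη
        have c1 : Continuous fun t => |η t| ^ (p - 2) :=
          (continuous_abs_rpow (by linarith)).comp cη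
        refine integral_eq_zero_of_hasDerivAt_of_integrable h1 (hcs _ ?_ fun t ht => ?_)
          (hcs _ c0 fun t ht => ?_)
        · fun_prop
        · rw [zη' t ht, mul_zero]
        · rw [zη t ht, abs_zero, Real.zero_rpow (by linarith)]
      have h3 : ∀ t, H 0 t = -(b * (|C| ^ (p - 2) * C)) * (p * |η t| ^ (p - 2) * η t * η' t) := by
        intro t
        have : y 0 t = -(C * η t) := by simp [y]
        simp only [H, this, abs_neg, abs_mul, Real.mul_rpow (abs_nonneg C) (abs_nonneg (η t))]
        ring
      simp only [h3]
      rw [integral_const_mul, h2, mul_zero]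
    have := hJ.tendsto 0
    simp only [hset, h0] at this
    exact this
  · have hy : Continuous (y ε) := by simp only [y]; fun_prop
    have c1 : Continuous fun t => |y ε t| ^ p := (continuous_abs_rpow (by linarith)).comp hy
    have c2 : Continuous fun t => |C * η t| ^ p :=
      (continuous_abs_rpow (by linarith)).comp (continuous_const.mul cη)
    have i1 : Integrable fun t => |y ε t| ^ p :=
      hcs _ c1 fun t ht => by
        simp [y, zη t ht, zη' t ht, zη'' t ht, Real.zero_rpow (show p ≠ 0 by linarith)]
    have i2 : Integrable fun t => |C * η t| ^ p :=
      hcs _ c2 fun t ht => by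
        simp [zη t ht, Real.zero_rpow (show p ≠ 0 by linarith)]
    have c3 : Continuous (H ε) := cH.uncurry_left ε
    have i3 : Integrable (H ε) := hcs _ c3 fun t ht => by simp [H, zη' t ht, zη'' t ht]
    change ε⁻¹ * ((∫ t, |y ε t| ^ p) - ∫ t, |C * η t| ^ p) ≤ ∫ t, H ε t
    rw [← integral_sub i1 i2, ← integral_const_mul]
    refine integral_mono ((i1.sub i2).const_mul _) i3 fun t => ?_
    have hconv := abs_rpow_add_le hp (y ε t) (-(C * η t))
    rw [abs_neg] at hconv
    have hdiff : -(C * η t) - y ε t = -(ε * (ε * η'' t + b * η' t)) := by simp only [y]; ring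
    rw [hdiff] at hconv
    simp only [H]
    rw [inv_mul_le_iff₀ hε]
    linarith

lemma TendstoC2Loc.of_eventuallyEq {N : ℕ} {u : ℕ → E N → ℝ} {v : E N → ℝ}
    (huv : ∀ K : Set (E N), IsCompact K → K ⊆ {0}ᶜ → ∀ᶠ n in atTop, ∀ x ∈ K, u n =ᶠ[𝓝 x] v) :
    TendstoC2Loc u v := by
  intro K hK hK0 k _
  rw [Metric.tendstoUniformlyOn_iff]
  intro ε hε
  filter_upwards [huv K hK hK0] with n hn x hx
  rw [((hn x hx).iteratedFDeriv ℝ k).eq_of_nhds, dist_self]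
  exact hε

/-- The sequence is `d^γ η(ε log d)` with `ε → 0`. Its left-hand integrals equal `c ε⁻¹ ∫ |η|^p`, so
they stay above a positive `δ`, which lets a vanishing deficit also give a quotient tending to the
constant. -/
theorem exists_maximizing_sequence (hd : IsPotential σ d β) (hp : 2 ≤ p)
    (hs : s = p * θ + 2 * p - 2) (hγ : p * γ = β + s) (hC : 0 ≤ const β p θ)
    (hi : ∀ u, IsTest u → Integrable (highDensity σ d p θ u))
    (hshell : ∀ a b : ℝ, 0 < a → a ≤ b → IsCompact {x : E N | x ≠ 0 ∧ a ≤ d x ∧ d x ≤ b}) :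
    ∃ (u : ℕ → E N → ℝ) (δ : ℝ), 0 < δ ∧ (∀ n, IsTest (u n)) ∧
      TendstoC2Loc u (fun x => d x ^ γ) ∧ (∀ n, δ ≤ ∫ x, lowDensity σ d p θ (u n) x) ∧
      Tendsto (fun n => (∫ x, highDensity σ d p θ (u n) x)
        - const β p θ ^ p * ∫ x, lowDensity σ d p θ (u n) x) atTop (𝓝 0) := by
  obtain ⟨c, hc0, hc⟩ := exists_integral_radial hd hshell
  obtain ⟨η, sη, kη, oneη⟩ := exists_cutoff
  have sη' : ContDiff ℝ ∞ (deriv η) := (contDiff_infty_iff_deriv.1 sη).2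
  have sη'' : ContDiff ℝ ∞ (deriv (deriv η)) := (contDiff_infty_iff_deriv.1 sη').2
  have hη : ∀ t, HasDerivAt η (deriv η t) t :=
    fun t => (sη.differentiable (by simp) t).hasDerivAt
  have hη' : ∀ t, HasDerivAt (deriv η) (deriv (deriv η) t) t :=
    fun t => (sη'.differentiable (by simp) t).hasDerivAt
  set C := const β p θ with hCdef
  have hCγ : C = γ * (β - γ) := const_eq hp hs hγ
  obtain ⟨J, hJ, hJle⟩ := exists_tendsto_deficit_bound hp (2 * γ - β) C hη hη' sη''.continuous kη
  let ε : ℕ → ℝ := fun n => 1 / ((n : ℝ) + 1)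
  have hε : ∀ n, 0 < ε n := fun n => by positivity
  have hε1 : ∀ n, ε n ≤ 1 := fun n => by
    rw [div_le_one (by positivity)]
    linarith [(Nat.cast_nonneg n : (0 : ℝ) ≤ n)]
  have hεlim : Tendsto ε atTop (𝓝 0) := tendsto_one_div_add_atTop_nhds_zero_nat
  let φ : ℕ → ℝ → ℝ := fun n t => η (ε n * t)
  have sφ : ∀ n, ContDiff ℝ ∞ (φ n) := fun n => sη.comp (contDiff_const.mul contDiff_id)
  have kφ : ∀ n, HasCompactSupport (φ n) := fun n =>
    kη.comp_homeomorph (Homeomorph.mulLeft₀ (ε n) (hε n).ne')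
  have hφ : ∀ n t, HasDerivAt (φ n) (ε n * deriv η (ε n * t)) t := fun n t =>
    ((hη _).comp t ((hasDerivAt_id t).const_mul (ε n))).congr_deriv (by simp [mul_comm])
  have hφ' : ∀ n t, HasDerivAt (fun t => ε n * deriv η (ε n * t))
      (ε n ^ 2 * deriv (deriv η) (ε n * t)) t := fun n t =>
    (((hη' _).comp t ((hasDerivAt_id t).const_mul (ε n))).const_mul (ε n)).congr_deriv
      (by simp only [mul_one, id]; ring)
  let u : ℕ → E N → ℝ := fun n => radial d fun t => Real.exp (γ * t) * φ n t
  have hu : ∀ n, IsTest (u n) := fun n => isTest_radial hd hshell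
    ((Real.contDiff_exp.comp (contDiff_const.mul contDiff_id)).mul (sφ n)) (kφ n).mul_left
  have scale : ∀ (n : ℕ) (g : ℝ → ℝ), ∫ t, g (ε n * t) = (ε n)⁻¹ * ∫ t, g t := fun n g => by
    rw [Measure.integral_comp_mul_left, abs_of_pos (inv_pos.2 (hε n)), smul_eq_mul]
  have hlow : ∀ n, ∫ x, lowDensity σ d p θ (u n) x = c * ((ε n)⁻¹ * ∫ t, |η t| ^ p) := fun n => by
    have cφ : Continuous fun t => |φ n t| ^ p :=
      (continuous_abs_rpow (by linarith)).comp (sφ n).continuous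
    rw [← scale n fun t => |η t| ^ p, ← hc _ cφ
      (hasCompactSupport_abs_rpow hp (fun t ht => image_eq_zero_of_notMem_tsupport ht) (kφ n))]
    refine integral_congr_ae ?_
    filter_upwards [hd.ae_ne_zero] with x hx using lowDensity_radial hd hs hγ hx
  have hhigh : ∀ n, ∫ x, highDensity σ d p θ (u n) x = c * ((ε n)⁻¹ *
      ∫ t, |ε n ^ 2 * deriv (deriv η) t + (2 * γ - β) * (ε n * deriv η t) - C * η t| ^ p) := by
    intro n
    rw [← scale n fun t =>
      |ε n ^ 2 * deriv (deriv η) t + (2 * γ - β) * (ε n * deriv η t) - C * η t| ^ p, ← hc _ ?_ ?_]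
    · refine integral_congr_ae ?_
      filter_upwards [hd.ae_ne_zero, hd.gradL_ne_zero] with x hx hg
      rw [hCγ]
      exact highDensity_radial hd hs hγ (hφ n) (hφ' n) hx hg
    · refine (continuous_abs_rpow (by linarith)).comp ?_
      have h1 := sη.continuous
      have h2 := sη'.continuous
      have h3 := sη''.continuous
      fun_prop
    · have k0 : HasCompactSupport fun t =>
          |ε n ^ 2 * deriv (deriv η) t + (2 * γ - β) * (ε n * deriv η t) - C * η t| ^ p := by
        refine hasCompactSupport_abs_rpow hp (fun t ht => ?_) kη
        have e0 : η =ᶠ[𝓝 t] fun _ => 0 := notMem_tsupport_iff_eventuallyEq.1 ht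
        have e1 : deriv η =ᶠ[𝓝 t] fun _ => 0 := by simpa using e0.deriv
        have e2 : deriv (deriv η) =ᶠ[𝓝 t] fun _ => 0 := by simpa using e1.deriv
        rw [e0.eq_of_nhds, e1.eq_of_nhds, e2.eq_of_nhds]
        ring
      exact k0.comp_homeomorph (Homeomorph.mulLeft₀ (ε n) (hε n).ne')
  have hI : 0 < ∫ t, |η t| ^ p := by
    refine Continuous.integral_pos_of_hasCompactSupport_nonneg_nonzero (x := 0)
      ((continuous_abs_rpow (by linarith)).comp sη.continuous)
      (hasCompactSupport_abs_rpow hp (fun t ht => image_eq_zero_of_notMem_tsupport ht) kη)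
      (fun t => Real.rpow_nonneg (abs_nonneg _) _) ?_
    simp [oneη 0 (by simp)]
  refine ⟨u, c * ∫ t, |η t| ^ p, mul_pos hc0 hI, hu, ?_, fun n => ?_, ?_⟩
  · refine TendstoC2Loc.of_eventuallyEq fun K hK hK0 => ?_
    have hlog : ContinuousOn (fun x => Real.log (d x)) {0}ᶜ :=
      hd.contDiffOn.continuousOn.log fun x hx => (hd.pos x hx).ne'
    -- Since `log d` is bounded on `K`, for large `n` the cutoff equals one near each point of `K`;
    -- there `u n` coincides with `d^γ`, and so do all derivatives.
    obtain ⟨M, hM⟩ := hK.exists_bound_of_continuousOn (hlog.mono hK0)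
    have hlim : Tendsto (fun n => ε n * M) atTop (𝓝 0) := by simpa using hεlim.mul_const M
    filter_upwards [hlim.eventually_lt_const one_pos] with n hn x hx
    have hx0 : x ≠ 0 := hK0 hx
    have hlt : |ε n * Real.log (d x)| < 1 := by
      rw [abs_mul, abs_of_pos (hε n)]
      exact (mul_le_mul_of_nonneg_left (hM x hx) (hε n).le).trans_lt hn
    have hcont : ContinuousAt (fun y => |ε n * Real.log (d y)|) x :=
      (continuousAt_const.mul (hlog.continuousAt (punctured_mem_nhds hx0))).abs
    filter_upwards [hcont.eventually_lt_const hlt, punctured_mem_nhds hx0] with y hy hy0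
    simp only [u, φ, radial_apply hy0, oneη _ hy, mul_one, exp_mul_log_eq_rpow (hd.pos y hy0)]
  · rw [hlow]
    refine mul_le_mul_of_nonneg_left ?_ hc0.le
    exact le_mul_of_one_le_left hI.le ((one_le_inv₀ (hε n)).2 (hε1 n))
  -- The deficit is nonnegative by `deficit_ge` and at most `c * J (ε n)`.
  · refine squeeze_zero (fun n => ?_) (fun n => ?_)
      (by simpa using (hJ.comp hεlim).const_mul c)
    · refine le_trans ?_ (deficit_ge hd hp hs hγ hC (hu n) (hi _ (hu n)))
      exact mul_nonneg (mul_nonneg (by linarith) (Real.rpow_nonneg hC _))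
        (mul_nonneg (by linarith) (integral_remDensity_nonneg hd))
    · have hCη : ∫ t, |C * η t| ^ p = C ^ p * ∫ t, |η t| ^ p := by
        rw [← integral_const_mul]
        refine integral_congr_ae (Eventually.of_forall fun t => ?_)
        simp only [abs_mul, abs_of_nonneg hC, Real.mul_rpow hC (abs_nonneg (η t))]
      have := mul_le_mul_of_nonneg_left (hJle (ε n) (hε n)) hc0.le
      rw [hCη] at this
      rw [hhigh, hlow]
      refine le_trans (le_of_eq ?_) this
      ring

end Sharpness

end Rellich

/-! ### Assembly of the theorem -/

theorem theorem1p2 {N h : ℕ} (hh : h ≤ N)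
    (σ : Fin h → Fin N → Rellich.E N → ℝ)
    (hσ : ∀ i j, ContDiffOn ℝ 1 (σ i j) {0}ᶜ)
    (d : Rellich.E N → ℝ)
    (hd : ContDiffOn ℝ ∞ d {0}ᶜ)
    (hdpos : ∀ x, x ≠ 0 → 0 < d x)
    (hnd : ∀ᵐ x : Rellich.E N, Rellich.gradL σ d x ≠ 0)
    (hreg : ∀ᵐ r : ℝ, 0 < r → ∀ x, x ≠ 0 → d x = r → ∇ d x ≠ 0)
    (β p θ : ℝ) (hp : 2 ≤ p)
    (hL : ∀ x, x ≠ 0 → Rellich.opL σ d x = (1 - β) * ‖Rellich.gradL σ d x‖ ^ 2 / d x)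
    (hloc : LocallyIntegrableOn
      (fun x => d x ^ (-(p * θ)) * ‖Rellich.gradL σ d x‖ ^ (-(2 * (p - 1)))) {0}ᶜ)
    (hsign : 0 ≤ (2 - β - p * θ - 2 * p) * (p * θ + 2 * p - 2 - β * (p - 1))) :
    -- the inequality
    (∀ u : Rellich.E N → ℝ, Rellich.IsTest u →
      Integrable (Rellich.lowDensity σ d p θ u) ∧
      Integrable (Rellich.highDensity σ d p θ u) ∧
      Rellich.const β p θ ^ p * ∫ x, Rellich.lowDensity σ d p θ u x
        ≤ ∫ x, Rellich.highDensity σ d p θ u x) ∧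
    -- sharpness and maximizing functions under the level set condition
    (∀ lam : ℝ, 0 < lam →
      (∀ᵐ r : ℝ, 0 < r →
        ∫⁻ x in {x : Rellich.E N | x ≠ 0 ∧ d x = r},
          ENNReal.ofReal (‖Rellich.gradL σ d x‖ ^ 2 / ‖∇ d x‖) ∂μH[(N : ℝ) - 1]
        = ENNReal.ofReal (lam * r ^ (1 - β))) →
      -- if the shells of `d` are compact, the constant is the infimum of the quotients,
      -- and the power of `d` is a maximizing function
      ((∀ a b : ℝ, 0 < a → a ≤ b → IsCompact {x : Rellich.E N | x ≠ 0 ∧ a ≤ d x ∧ d x ≤ b}) →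
        IsGLB {q : ℝ | ∃ u : Rellich.E N → ℝ, Rellich.IsTest u ∧ u ≠ 0 ∧
            q = (∫ x, Rellich.highDensity σ d p θ u x) / ∫ x, Rellich.lowDensity σ d p θ u x}
          (Rellich.const β p θ ^ p) ∧
        Rellich.IsMaximizing σ d β p θ (fun x => d x ^ ((β + p * θ + 2 * p - 2) / p))) ∧
      -- no nonzero admissible function achieves the equality
      (∀ u : Rellich.E N → ℝ, Rellich.IsTest u → u ≠ 0 →
        Rellich.const β p θ ^ p * ∫ x, Rellich.lowDensity σ d p θ u x
          < ∫ x, Rellich.highDensity σ d p θ u x) ∧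
      -- uniqueness of the maximizing function when the constant is not zero
      (0 < Rellich.const β p θ → ∀ v : Rellich.E N → ℝ, Rellich.IsMaximizing σ d β p θ v →
        (∀ x, x ≠ 0 → Rellich.gradL σ
          (fun y => d y ^ (-((β + p * θ + 2 * p - 2) / p)) * v y) x = 0) ∧
        ((∀ w : Rellich.E N → ℝ, ContDiffOn ℝ 1 w {0}ᶜ →
            (∀ x, x ≠ 0 → Rellich.gradL σ w x = 0) → ∃ c : ℝ, ∀ x, x ≠ 0 → w x = c) →
          ∃ c : ℝ, ∀ x, x ≠ 0 → v x = c * d x ^ ((β + p * θ + 2 * p - 2) / p)))) := by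
  have hd' : Rellich.IsPotential σ d β := ⟨hσ, hd, hdpos, hnd, hL⟩
  have hp0 : p ≠ 0 := by linarith
  have hC : 0 ≤ Rellich.const β p θ := div_nonneg hsign (by positivity)
  obtain ⟨γ, hγdef⟩ : ∃ γ : ℝ, γ = (β + p * θ + 2 * p - 2) / p := ⟨_, rfl⟩
  have hs : p * θ + 2 * p - 2 = p * θ + 2 * p - 2 := rfl
  have hγ : p * γ = β + (p * θ + 2 * p - 2) := by
    rw [hγdef]
    field_simp
    ring
  rw [← hγdef]
  have hi : ∀ u, Rellich.IsTest u → MeasureTheory.Integrable (Rellich.highDensity σ d p θ u) :=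
    fun u hu => Rellich.integrable_highDensity hd' hp hloc hu
  have hstrict : ∀ u : Rellich.E N → ℝ, Rellich.IsTest u → u ≠ 0 →
      Rellich.const β p θ ^ p * ∫ x, Rellich.lowDensity σ d p θ u x
        < ∫ x, Rellich.highDensity σ d p θ u x :=
    fun u hu hu0 => Rellich.strict_inequality hd' hp hC hu (hi u hu) hu0
  refine ⟨fun u hu => ⟨Rellich.integrable_lowDensity hd' hp hu, hi u hu, ?_⟩,
    fun lam _ _ => ⟨fun hshell => ?_, hstrict, fun hC0 v hv => ?_⟩⟩
  · rcases eq_or_ne u 0 with rfl | hu0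
    · refine le_of_eq ?_
      have h1 : ∀ x, Rellich.lowDensity σ d p θ 0 x = 0 := fun x =>
        Rellich.lowDensity_eq_zero hp rfl
      have h2 : ∀ x, Rellich.highDensity σ d p θ 0 x = 0 := fun x =>
        Rellich.highDensity_eq_zero hp (Rellich.opL_zero x)
      simp [h1, h2]
    · exact (hstrict u hu hu0).le
  · obtain ⟨u, δ, hδ, hu, huv, hlow, hlim⟩ :=
      Rellich.exists_maximizing_sequence hd' hp hs hγ hC hi hshell
    have hpos : ∀ n, 0 < ∫ x, Rellich.lowDensity σ d p θ (u n) x := fun n => hδ.trans_le (hlow n)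
    refine ⟨⟨?_, fun b hb => ?_⟩, (hd'.contDiffOn_rpow γ).of_le
      (WithTop.coe_le_coe.2 (le_top : (2 : ℕ∞) ≤ ⊤)), u, hu, huv, hlim⟩
    · rintro q ⟨w, hw, hw0, rfl⟩
      rw [le_div_iff₀ (Rellich.integral_lowDensity_pos hd' hp hw hw0)]
      exact (hstrict w hw hw0).le
    -- The quotient minus `C^p` is the deficit divided by the left-hand integral, which is at least
    -- `δ`; both tend to zero together.
    · have hq : Tendsto (fun n => (∫ x, Rellich.highDensity σ d p θ (u n) x)
          / ∫ x, Rellich.lowDensity σ d p θ (u n) x) atTop (𝓝 (Rellich.const β p θ ^ p)) := by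
        have h0 : Tendsto (fun n => ((∫ x, Rellich.highDensity σ d p θ (u n) x)
            - Rellich.const β p θ ^ p * ∫ x, Rellich.lowDensity σ d p θ (u n) x)
            / ∫ x, Rellich.lowDensity σ d p θ (u n) x) atTop (𝓝 0) := by
          have hnn : ∀ n, 0 ≤ (∫ x, Rellich.highDensity σ d p θ (u n) x)
              - Rellich.const β p θ ^ p * ∫ x, Rellich.lowDensity σ d p θ (u n) x := fun n => by
            rcases eq_or_ne (u n) 0 with h | h
            · exact absurd (hpos n) (by
                rw [h, MeasureTheory.integral_congr_ae (Eventually.of_forall fun x =>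
                  Rellich.lowDensity_eq_zero hp (Pi.zero_apply x))]
                simp)
            · exact sub_nonneg.2 (hstrict _ (hu n) h).le
          refine squeeze_zero (fun n => div_nonneg (hnn n) (hpos n).le)
            (fun n => div_le_div_of_nonneg_left (hnn n) hδ (hlow n))
            (by simpa using hlim.div_const δ)
        have h1 := h0.add_const (Rellich.const β p θ ^ p)
        rw [zero_add] at h1
        refine h1.congr fun n => ?_
        have := (hpos n).ne'
        field_simp
        ring
      refine ge_of_tendsto' hq fun n => hb ⟨u n, hu n, fun h => ?_, rfl⟩
      refine (hpos n).ne' ?_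
      rw [h, MeasureTheory.integral_congr_ae (Eventually.of_forall fun x =>
        Rellich.lowDensity_eq_zero hp (Pi.zero_apply x))]
      simp
  · have hgrad : ∀ x, x ≠ 0 → Rellich.gradL σ (fun y => d y ^ (-γ) * v y) x = 0 := fun x hx =>
      Rellich.gradL_weighted_eq_zero_of_isMaximizing hd' hp hs hγ hC0 hi hv hx
    refine ⟨hgrad, fun hLiouville => ?_⟩
    obtain ⟨c, hc⟩ := hLiouville (fun y => d y ^ (-γ) * v y)
      (((hd'.contDiffOn_rpow _).of_le (by exact_mod_cast (le_top : (1 : ℕ∞) ≤ ⊤))).mul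
        (hv.1.of_le one_le_two)) hgrad
    refine ⟨c, fun x hx => ?_⟩
    have hD := Real.rpow_pos_of_pos (hdpos x hx) γ
    rw [← hc x hx, Real.rpow_neg (hdpos x hx).le]
    field_simp
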